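/- **Setting.** Let $D\subset\mathbb R^d$ be a bounded domain (open, connected, non-empty), $\gamma>1$, $a>0$. "Smooth" means $C^\infty$ in $D$ with all derivatives bounded in $D$. Let $\Phi$ be a smooth potential and $\alpha,\beta$ a smooth reference density and pressure, independent of time and of the Mach number $M$, with $\alpha$ bounded below by a positive constant and $\nabla\beta=-\alpha\nabla\Phi$ (Froude number equal to $M$). A state is $w=(\rho,\rho\mathbf u,E)$, with $E=\rho e+\tfrac12M^2\rho|\mathbf u|^2$ and $p=(\gamma-1)\rho e$. A family $f=f_M$ *has a Mach expansion to order $N$* if $f_M=f_0+Mf_1+\dots+M^Nf_N+\mathcal O(M^{N+1})$ as $M\to0^+$, where each $f_M$ ($M$ small) is $C^\infty$ in $D$, the coefficients are smooth and the remainder is uniform in $D$ together with each space derivative. **Well-prepared data.** $w\in\Omega_{wp}^{\alpha\beta}$ means that in $D$ $$\nabla p_0=\rho_0\tfrac{\nabla\beta}{\alpha},\quad \nabla p_1=\rho_1\tfrac{\nabla\beta}{\alpha},\quad \nabla\cdot(\rho_0\mathbf u_0)=0,\quad \nabla\cdot\mathbf u_0=0,\quad \mathbf u_0\cdot\tfrac{\nabla\beta}{\alpha}=0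 .$$ "Up to $\varepsilon$" means that the residual of each of these five equations is at most $\varepsilon$ in absolute value throughout $D$. **Scheme.** Let $W=(\rho,\rho\mathbf u,E,\rho\pi,\rho\hat{\mathbf u},\rho\psi,\rho Z)$, $W^{eq}=(\rho,\rho\mathbf u,E,\rho p,\rho\mathbf u,\rho p,\rho\beta)$, and $$F(W)=\begin{pmatrix}\rho\mathbf u\\ \rho\mathbf u\otimes\mathbf u+(\pi+\frac{1-M^2}{M^2}\psi)\mathbb I\\ (E+M^2\pi+(1-M^2)\psi)\mathbf u\\ \rho\pi\mathbf u+a^2\mathbf u\\ \rho\mathbf u\otimes\hat{\mathbf u}\\ \rho\psi\mathbf u\\ \rho Z\mathbf u\end{pmatrix},\quad S_E(W)=\begin{pmatrix}0\\ \frac1{M^2}\frac\rho\alpha\nabla Z\\ \frac\rho\alpha\mathbf u\cdot\nabla Z\\0\\0\\0\\0\end{pmatrix},\quad G(W)=\begin{pmatrix}0\\0\\0\\0\\ \psi\mathbb I\\ a^2M^2\hat{\mathbf u}\\0\end{pmatrix},\quad S_I(W)=\begin{pmatrix}0\\0\\0\\0\\ \frac\rho\alpha\nabla Z\\0\\0\end{pmatrix}.$$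 Here, for the flux $\rho\mathbf u\otimes\hat{\mathbf u}$, the $i$-th component of the divergence is $\nabla\cdot(\rho\hat u_i\mathbf u)$. One time step of size $\Delta t$ consists, in $D$, of $$W^{(1)}-W^{n,eq}+\tfrac{\Delta t}{M^2}\nabla\cdot G(W^{(1)})=\tfrac{\Delta t}{M^2}S_I(W^{(1)}),\qquad W^{(2)}-W^{(1)}+\Delta t\,\nabla\cdot F(W^{(1)})=\Delta t\,S_E(W^{(1)}),\qquad W^{n+1}=W^{(2),eq}.$$ **Theorem (AP property).** Let $K\ge0$ be an integer and let $w^n=w^n_M$ be a family of states, independent of $\Delta t$, such that $\rho^n,\mathbf u^n,p^n$ have Mach expansions to order $K+2$, $\rho^n_0$ is bounded below by a positive constant, and $w^n\in\Omega_{wp}^{\alpha\beta}$. Let $T>0$, and for every $\Delta t\in(0,T]$ and all small $M>0$ (how small may depend on $\Delta t$) let $W^{(1)},W^{(2)},W^{n+1}$ be one step of the scheme from $w^n$. Assume that for every $\Delta t\in(0,T]$ the implicit pressure $\psi^{(1)}$ has a Mach expansion to order $K+2$ with coefficients $\psi^{(1)}_k$ (depending on $\Delta t$), that $\nabla\psi^{(1)}_2$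 is bounded uniformly in $D$ and in $\Delta t\in(0,T]$, and that the pressure boundary conditions $$\nabla\psi^{(1)}_0=\nabla p^n_0,\qquad \nabla\psi^{(1)}_1=\nabla p^n_1\qquad\text{on }\partial D$$ hold (in the sense that $\nabla\psi^{(1)}_k(x)-\nabla p^n_k(x)\to0$ as $x\in D$ tends to any point of $\partial D$). Then for every $\Delta t\in(0,T]$ the quantities $\rho^{n+1},p^{n+1}$ have Mach expansions to order $K+2$ and $\mathbf u^{n+1}$ has one to order $K$, and there is a constant $C$ independent of $\Delta t$ such that for all $\Delta t\in(0,T]$: 1. (*The set of well-prepared data is preserved up to $\mathcal O(\Delta t)$.*) In $D$, $\rho_0^{n+1}=\rho_0^n$, $p_0^{n+1}=p_0^n$, $|\rho_1^{n+1}-\rho_1^n|\le C\Delta t$, $|p_1^{n+1}-p_1^n|\le C\Delta t$, and $w^{n+1}\in\Omega_{wp}^{\alpha\beta}$ up to $C\Delta t$. 2. (*The limit $M\to0$ is a time discretization of the incompressible Euler equations with gravity* $$\nabla\cdot(\rho_0\mathbf u_0)=0,\quad \partial_t\mathbf u_0+\mathbf u_0\cdot\nabla\mathbf u_0+\frac{\nabla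 p_2}{\rho_0}=-\frac{\rho_2\nabla\Phi}{\rho_0},\quad\nabla\cdot\mathbf u_0=0,\quad\mathbf u_0\cdot\nabla\Phi=0$$ *within $\mathcal O(\Delta t)$ terms.*) In $D$, $\rho_0^{n+1}=\rho_0^n$, $$\frac{\mathbf u_0^{n+1}-\mathbf u_0^n}{\Delta t}+\mathbf u_0^n\cdot\nabla\mathbf u_0^n+\frac{\nabla\psi_2^{(1)}}{\rho_0^n}=-\frac{\rho_2^n\nabla\Phi}{\rho_0^n},$$ where $\psi_2^{(1)}$ plays the role of $p_2$, and $|\nabla\cdot(\rho_0^{n+1}\mathbf u_0^{n+1})|$, $|\nabla\cdot\mathbf u_0^{n+1}|$, $|\mathbf u_0^{n+1}\cdot\nabla\Phi|$ are all at most $C\Delta t$. -/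

import Mathlib

open Filter Topology
open scoped ContDiff

noncomputable section

namespace LowMach

/-- Physical space `ℝ^d`. -/
abbrev Space (d : ℕ) := EuclideanSpace ℝ (Fin d)

/-! ### Differential operators -/

/-- The divergence `∇ · V` of a vector field. -/
def divg {d : ℕ} (V : Space d → Space d) (x : Space d) : ℝ :=
  ∑ i, fderiv ℝ V x (EuclideanSpace.single i 1) i

/-- The divergence of a tensor field given by its rows: the `i`-th component is `∇ · T i`. -/
def tensorDivg {d : ℕ} (T : Fin d → Space d → Space d) (x : Space d) : Space d :=
  WithLp.toLp 2 fun i => divg (T i) x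

/-- The directional derivative `(u · ∇) v`. -/
def advect {d : ℕ} (u v : Space d → Space d) (x : Space d) : Space d :=
  fderiv ℝ v x (u x)

/-! ### Physical states and relaxation states -/

/-- The physical variables `w = (ρ, ρ u, E)`. -/
structure State (d : ℕ) where
  rho : Space d → ℝ
  mom : Space d → Space d
  energy : Space d → ℝ

/-- The velocity `u`. -/
def State.velocity {d : ℕ} (w : State d) (x : Space d) : Space d :=
  (w.rho x)⁻¹ • w.mom x

/-- The internal energy `e`, defined by `E = ρ e + (1/2) M² ρ |u|²`. -/
def State.internalEnergy {d : ℕ} (M : ℝ) (w : State d) (x : Space d) : ℝ :=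
  (w.energy x - 1 / 2 * M ^ 2 * w.rho x * ‖w.velocity x‖ ^ 2) / w.rho x

/-- The pressure, given by the ideal gas law `p = (γ - 1) ρ e`. -/
def State.pressure {d : ℕ} (γ M : ℝ) (w : State d) (x : Space d) : ℝ :=
  (γ - 1) * w.rho x * w.internalEnergy M x

/-- The relaxation variables `W = (ρ, ρ u, E, ρ π, ρ û, ρ ψ, ρ Z)`. -/
structure RelaxState (d : ℕ) where
  rho : Space d → ℝ
  mom : Space d → Space d
  energy : Space d → ℝ
  rhoPi : Space d → ℝ
  rhoUhat : Space d → Space d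
  rhoPsi : Space d → ℝ
  rhoZ : Space d → ℝ

namespace RelaxState

variable {d : ℕ}

/-- The vector `W(x)` of the relaxation variables at a point. -/
def val (W : RelaxState d) (x : Space d) :
    ℝ × Space d × ℝ × ℝ × Space d × ℝ × ℝ :=
  (W.rho x, W.mom x, W.energy x, W.rhoPi x, W.rhoUhat x, W.rhoPsi x, W.rhoZ x)

/-- The velocity `u`. -/
def velocity (W : RelaxState d) (x : Space d) : Space d := (W.rho x)⁻¹ • W.mom x

/-- The slow pressure `π`. -/
def slowPressure (W : RelaxState d) (x : Space d) : ℝ := W.rhoPi x / W.rho x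

/-- The relaxation velocity `û`. -/
def uhat (W : RelaxState d) (x : Space d) : Space d := (W.rho x)⁻¹ • W.rhoUhat x

/-- The fast pressure `ψ`. -/
def psi (W : RelaxState d) (x : Space d) : ℝ := W.rhoPsi x / W.rho x

/-- The relaxed equilibrium pressure `Z`. -/
def zed (W : RelaxState d) (x : Space d) : ℝ := W.rhoZ x / W.rho x

/-- The physical part `w = Q W`. -/
def phys (W : RelaxState d) : State d where
  rho := W.rho
  mom := W.mom
  energy := W.energy

end RelaxState

/-- The relaxation equilibrium `W^eq = (ρ, ρ u, E, ρ p, ρ u, ρ p, ρ β)`. -/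
def State.equilibrium {d : ℕ} (γ M : ℝ) (β : Space d → ℝ) (w : State d) : RelaxState d where
  rho := w.rho
  mom := w.mom
  energy := w.energy
  rhoPi := fun x => w.rho x * w.pressure γ M x
  rhoUhat := w.mom
  rhoPsi := fun x => w.rho x * w.pressure γ M x
  rhoZ := fun x => w.rho x * β x

/-- A flux for the relaxation variables: one vector field for every scalar variable, one tensor
field (given by rows) for every vector variable. -/
structure RelaxFlux (d : ℕ) where
  rho : Space d → Space d
  mom : Fin d → Space d → Space d
  energy : Space d → Space d
  rhoPi : Space d → Space d
  rhoUhat : Fin d → Space d → Space d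
  rhoPsi : Space d → Space d
  rhoZ : Space d → Space d

/-- The divergence of a flux. -/
def RelaxFlux.div {d : ℕ} (F : RelaxFlux d) : RelaxState d where
  rho := divg F.rho
  mom := tensorDivg F.mom
  energy := divg F.energy
  rhoPi := divg F.rhoPi
  rhoUhat := tensorDivg F.rhoUhat
  rhoPsi := divg F.rhoPsi
  rhoZ := divg F.rhoZ

/-- The explicit flux `F(W)`. -/
def fluxF {d : ℕ} (a M : ℝ) (W : RelaxState d) : RelaxFlux d where
  rho := fun x => W.mom x
  mom := fun i x => W.mom x i • W.velocity x +
    (W.slowPressure x + (1 - M ^ 2) / M ^ 2 * W.psi x) • EuclideanSpace.single i 1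
  energy := fun x =>
    (W.energy x + M ^ 2 * W.slowPressure x + (1 - M ^ 2) * W.psi x) • W.velocity x
  rhoPi := fun x => W.rhoPi x • W.velocity x + a ^ 2 • W.velocity x
  rhoUhat := fun i x => W.rhoUhat x i • W.velocity x
  rhoPsi := fun x => W.rhoPsi x • W.velocity x
  rhoZ := fun x => W.rhoZ x • W.velocity x

/-- The explicit source `S_E(W)`. -/
def sourceE {d : ℕ} (M : ℝ) (α : Space d → ℝ) (W : RelaxState d) : RelaxState d where
  rho := 0
  mom := fun x => (1 / M ^ 2 * (W.rho x / α x)) • gradient W.zed x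
  energy := fun x => W.rho x / α x * inner ℝ (W.velocity x) (gradient W.zed x)
  rhoPi := 0
  rhoUhat := 0
  rhoPsi := 0
  rhoZ := 0

/-- The implicit flux `G(W)`, which enters with the factor `1 / M²`. -/
def fluxG {d : ℕ} (a M : ℝ) (W : RelaxState d) : RelaxFlux d where
  rho := 0
  mom := 0
  energy := 0
  rhoPi := 0
  rhoUhat := fun i x => W.psi x • EuclideanSpace.single i 1
  rhoPsi := fun x => (a ^ 2 * M ^ 2) • W.uhat x
  rhoZ := 0

/-- The implicit source `S_I(W)`, which enters with the factor `1 / M²`. -/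
def sourceI {d : ℕ} (α : Space d → ℝ) (W : RelaxState d) : RelaxState d where
  rho := 0
  mom := 0
  energy := 0
  rhoPi := 0
  rhoUhat := fun x => (W.rho x / α x) • gradient W.zed x
  rhoPsi := 0
  rhoZ := 0

/-- One step `wⁿ ↦ W⁽¹⁾ ↦ W⁽²⁾ ↦ Wⁿ⁺¹` of the time semi-discrete IMEX scheme on `D`. -/
structure IsIMEXStep {d : ℕ} (D : Set (Space d)) (γ a M dt : ℝ) (α β : Space d → ℝ)
    (w : State d) (W₁ W₂ Wnew : RelaxState d) : Prop where
  implicit_step : ∀ x ∈ D,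
    W₁.val x - (w.equilibrium γ M β).val x + (dt / M ^ 2) • (fluxG a M W₁).div.val x
      = (dt / M ^ 2) • (sourceI α W₁).val x
  explicit_step : ∀ x ∈ D,
    W₂.val x - W₁.val x + dt • (fluxF a M W₁).div.val x = dt • (sourceE M α W₁).val x
  projection : ∀ x ∈ D, Wnew.val x = (W₂.phys.equilibrium γ M β).val x

/-! ### Mach number expansions -/

/-- `f` is smooth in `D`, with every derivative bounded in `D`. -/
structure SmoothBdd {d : ℕ} {V : Type*} [NormedAddCommGroup V] [NormedSpace ℝ V]
    (D : Set (Space d)) (f : Space d → V) : Prop where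
  smooth : ContDiffOn ℝ ∞ f D
  bounded : ∀ j : ℕ, ∃ C : ℝ, ∀ x ∈ D, ‖iteratedFDeriv ℝ j f x‖ ≤ C

/-- The family `f M` has the expansion `c 0 + M c 1 + ⋯ + M^N c N + O(M^(N+1))` as `M → 0⁺`,
with smooth coefficients, uniformly in `D` together with all space derivatives. -/
structure HasMachExpansion {d : ℕ} {V : Type*} [NormedAddCommGroup V] [NormedSpace ℝ V]
    (D : Set (Space d)) (N : ℕ) (f : ℝ → Space d → V) (c : ℕ → Space d → V) : Prop where
  coeff : ∀ k ≤ N, SmoothBdd D (c k)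
  smooth : ∀ᶠ M : ℝ in 𝓝[>] 0, ContDiffOn ℝ ∞ (f M) D
  remainder : ∀ j : ℕ, ∃ C : ℝ, ∀ᶠ M : ℝ in 𝓝[>] 0, ∀ x ∈ D,
    ‖iteratedFDeriv ℝ j (fun y => f M y - ∑ k ∈ Finset.range (N + 1), M ^ k • c k y) x‖
      ≤ C * M ^ (N + 1)

/-! ### Well-prepared data -/

/-- The conditions on the expansion coefficients `ρ k`, `u k`, `p k` that define the set of
well-prepared data for the equilibrium density `α` and pressure `β`. -/
structure IsWellPrepared {d : ℕ} (D : Set (Space d)) (α β : Space d → ℝ)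
    (ρ : ℕ → Space d → ℝ) (u : ℕ → Space d → Space d) (p : ℕ → Space d → ℝ) : Prop where
  hydrostatic_zero : ∀ x ∈ D, gradient (p 0) x = ρ 0 x • ((α x)⁻¹ • gradient β x)
  hydrostatic_one : ∀ x ∈ D, gradient (p 1) x = ρ 1 x • ((α x)⁻¹ • gradient β x)
  div_momentum : ∀ x ∈ D, divg (fun y => ρ 0 y • u 0 y) x = 0
  div_velocity : ∀ x ∈ D, divg (u 0) x = 0
  orthogonal : ∀ x ∈ D, inner ℝ (u 0 x) ((α x)⁻¹ • gradient β x) = 0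

/-- The same conditions up to an error of size `ε`, uniformly in `D`. -/
structure IsWellPreparedUpTo {d : ℕ} (ε : ℝ) (D : Set (Space d)) (α β : Space d → ℝ)
    (ρ : ℕ → Space d → ℝ) (u : ℕ → Space d → Space d) (p : ℕ → Space d → ℝ) : Prop where
  hydrostatic_zero : ∀ x ∈ D, ‖gradient (p 0) x - ρ 0 x • ((α x)⁻¹ • gradient β x)‖ ≤ ε
  hydrostatic_one : ∀ x ∈ D, ‖gradient (p 1) x - ρ 1 x • ((α x)⁻¹ • gradient β x)‖ ≤ ε
  div_momentum : ∀ x ∈ D, |divg (fun y => ρ 0 y • u 0 y) x| ≤ ε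
  div_velocity : ∀ x ∈ D, |divg (u 0) x| ≤ ε
  orthogonal : ∀ x ∈ D, |inner ℝ (u 0 x) ((α x)⁻¹ • gradient β x)| ≤ ε

/-- One forward Euler step of size `dt`, from `(ρ₀, u₀)` to `(ρ₀', u₀')`, for the incompressible
Euler equations with gravity
`∇·(ρ₀ u₀) = 0`, `∂ₜ u₀ + u₀·∇u₀ + ∇q / ρ₀ = - ρ₂ ∇Φ / ρ₀`, `∇·u₀ = 0`, `u₀·∇Φ = 0`
with time-independent `ρ₀`: the evolution equations hold exactly in discrete form, with the
density perturbation `ρ₂` and the pressure `q`, and the three constraints hold at the new time up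
to an error `ε`. -/
structure IsLimitStepUpTo {d : ℕ} (ε : ℝ) (D : Set (Space d)) (dt : ℝ) (Φ : Space d → ℝ)
    (ρ₀ ρ₂ q : Space d → ℝ) (u₀ : Space d → Space d)
    (ρ₀' : Space d → ℝ) (u₀' : Space d → Space d) : Prop where
  density : ∀ x ∈ D, ρ₀' x = ρ₀ x
  momentum : ∀ x ∈ D,
    dt⁻¹ • (u₀' x - u₀ x) + advect u₀ u₀ x + (ρ₀ x)⁻¹ • gradient q x
      = -((ρ₂ x / ρ₀ x) • gradient Φ x)
  div_momentum : ∀ x ∈ D, |divg (fun y => ρ₀' y • u₀' y) x| ≤ ε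
  div_velocity : ∀ x ∈ D, |divg u₀' x| ≤ ε
  orthogonal : ∀ x ∈ D, |inner ℝ (u₀' x) (gradient Φ x)| ≤ ε

end LowMach

end

/-! The implicit stage changes only `û` and `ψ`. Eliminating `û` leaves one scalar elliptic
equation, `dt² a² ∇·X = M² (ρ (ψ - p) + dt a² ∇·u)` with `X = (∇ψ + ρ ∇Φ) / ρ`. Everything rests on
reading this equation order by order in `M` (`IsPrepared.implicit_pressure`).

At order zero, hydrostatic balance gives `∇(ψ₀ - p₀) = ρ₀ X₀`, while `∇·X₀ = 0`. So `f = ψ₀ - p₀`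
solves `∇·(ρ₀⁻¹ ∇f) = 0`, and `∇f` vanishes on the boundary. An energy argument that needs no
regularity of `∂D` (`gradient_eq_zero_of_divg_eq_zero`) gives `∇f = 0`, hence `X₀ = 0`; then order
one gives `X₁ = 0` in the same way. Therefore `∇ψ + ρ ∇Φ = O(M²)`, and the singular term `M⁻² (∇ψ +
ρ ∇Φ)` of the explicit momentum update is regular, at the cost of two orders of the expansion. Its
leading coefficient `ρ₀ X₂ = ∇ψ₂ + ρ₂ ∇Φ` is the pressure and gravity term of the limit equation.

Boundary conditions on gradients determine `ψ₀` only up to a constant: `ψ₀ = p₀ + κ`. The constant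
enters the energy flux and, at order two, `∇·X₂ = κ ρ₀ / (dt² a²)`. The assumed bound on `∇ψ₂`
bounds `X₂` uniformly in `dt`, but says nothing about its derivatives. Testing the divergence
equation against one fixed bump function (`exists_bound_of_divg_eq`) bounds `κ / dt²` by `sup ‖X₂‖`.
Hence `∇·X₂ = O(1)` and `κ = O(dt²)`, which is what the divergence constraints and the first order
pressure at the new time require (`IsPrepared.exists_uniform_bound`).

The formal comparison of powers of `M` is justified by a calculus of expansions: they are stable
under derivatives, bilinear products and division by a density bounded below, and their coefficients
are unique. -/

noncomputable section

namespace LowMach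

/-! ### Families of uniform order `M ^ n` -/

section UniformOrder

variable {d : ℕ} {D : Set (Space d)}
  {U V W : Type*} [NormedAddCommGroup U] [NormedSpace ℝ U]
  [NormedAddCommGroup V] [NormedSpace ℝ V] [NormedAddCommGroup W] [NormedSpace ℝ W]

/-- The family `f M` is smooth in `D` for small `M`, and every derivative is `O(M ^ n)` uniformly
in `D`. -/
structure UniformOrder (D : Set (Space d)) (n : ℕ) (f : ℝ → Space d → V) : Prop where
  smooth : ∀ᶠ M : ℝ in 𝓝[>] 0, ContDiffOn ℝ ∞ (f M) D
  bound : ∀ j : ℕ, ∃ C : ℝ, ∀ᶠ M : ℝ in 𝓝[>] 0, ∀ x ∈ D,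
    ‖iteratedFDeriv ℝ j (f M) x‖ ≤ C * M ^ n

theorem eventually_pos_lt_one : ∀ᶠ M : ℝ in 𝓝[>] 0, 0 < M ∧ M < 1 :=
  Ioo_mem_nhdsGT one_pos

theorem iteratedFDeriv_congr_on (hD : IsOpen D) {f g : Space d → V} (h : Set.EqOn f g D) (j : ℕ)
    {x : Space d} (hx : x ∈ D) : iteratedFDeriv ℝ j f x = iteratedFDeriv ℝ j g x :=
  ((h.eventuallyEq_of_mem (hD.mem_nhds hx)).iteratedFDeriv ℝ j).eq_of_nhds

theorem _root_.ContDiffOn.top_contDiffAt (hD : IsOpen D) {f : Space d → V}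
    (hf : ContDiffOn ℝ ∞ f D) {x : Space d} (hx : x ∈ D) (n : ℕ) : ContDiffAt ℝ n f x :=
  (hf.contDiffAt (hD.mem_nhds hx)).of_le (by exact_mod_cast le_top)

namespace UniformOrder

theorem congr (hD : IsOpen D) {n : ℕ} {f g : ℝ → Space d → V} (hf : UniformOrder D n f)
    (h : ∀ᶠ M : ℝ in 𝓝[>] 0, Set.EqOn (f M) (g M) D) : UniformOrder D n g where
  smooth := by
    filter_upwards [hf.smooth, h] with M h1 h2
    exact h1.congr fun x hx => (h2 hx).symm
  bound j := by
    obtain ⟨C, hC⟩ := hf.bound j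
    refine ⟨C, ?_⟩
    filter_upwards [hC, h] with M h1 h2 x hx
    rw [← iteratedFDeriv_congr_on hD h2 j hx]
    exact h1 x hx

theorem exists_nonneg_bound {n : ℕ} {f : ℝ → Space d → V} (hf : UniformOrder D n f) (j : ℕ) :
    ∃ C : ℝ, 0 ≤ C ∧ ∀ᶠ M : ℝ in 𝓝[>] 0, ∀ x ∈ D, ‖iteratedFDeriv ℝ j (f M) x‖ ≤ C * M ^ n := by
  obtain ⟨C, hC⟩ := hf.bound j
  refine ⟨max C 0, le_max_right _ _, ?_⟩
  filter_upwards [hC, eventually_pos_lt_one] with M h1 h2 x hx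
  exact (h1 x hx).trans (mul_le_mul_of_nonneg_right (le_max_left _ _) (pow_pos h2.1 n).le)

theorem add (hD : IsOpen D) {n : ℕ} {f g : ℝ → Space d → V} (hf : UniformOrder D n f)
    (hg : UniformOrder D n g) : UniformOrder D n (fun M x => f M x + g M x) where
  smooth := by
    filter_upwards [hf.smooth, hg.smooth] with M h1 h2
    exact h1.add h2
  bound j := by
    obtain ⟨C, hC⟩ := hf.bound j
    obtain ⟨C', hC'⟩ := hg.bound j
    refine ⟨C + C', ?_⟩
    filter_upwards [hC, hC', hf.smooth, hg.smooth] with M h1 h2 h3 h4 x hx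
    have := iteratedFDeriv_add_apply (h3.top_contDiffAt hD hx j) (h4.top_contDiffAt hD hx j)
    change ‖iteratedFDeriv ℝ j (f M + g M) x‖ ≤ _
    rw [this, add_mul]
    exact (norm_add_le _ _).trans (add_le_add (h1 x hx) (h2 x hx))

/-- Multiplication by a function of `M` alone. -/
theorem scale (hD : IsOpen D) {n m : ℕ} {f : ℝ → Space d → V} (hf : UniformOrder D n f)
    (s : ℝ → ℝ) (B : ℝ) (hs : ∀ᶠ M : ℝ in 𝓝[>] 0, |s M| * M ^ n ≤ B * M ^ m) :
    UniformOrder D m (fun M x => s M • f M x) where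
  smooth := by
    filter_upwards [hf.smooth] with M h1
    exact contDiffOn_const.smul h1
  bound j := by
    obtain ⟨C, hC0, hC⟩ := hf.exists_nonneg_bound j
    refine ⟨C * B, ?_⟩
    filter_upwards [hC, hs, hf.smooth] with M h1 h2 h3 x hx
    have := iteratedFDeriv_const_smul_apply (a := s M) (h3.top_contDiffAt hD hx j)
    change ‖iteratedFDeriv ℝ j (s M • f M) x‖ ≤ _
    rw [this, norm_smul, Real.norm_eq_abs]
    calc |s M| * ‖iteratedFDeriv ℝ j (f M) x‖ ≤ |s M| * (C * M ^ n) :=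
          mul_le_mul_of_nonneg_left (h1 x hx) (abs_nonneg _)
      _ = C * (|s M| * M ^ n) := by ring
      _ ≤ C * (B * M ^ m) := mul_le_mul_of_nonneg_left h2 hC0
      _ = C * B * M ^ m := by ring

theorem const_smul (hD : IsOpen D) {n : ℕ} {f : ℝ → Space d → V} (hf : UniformOrder D n f)
    (s : ℝ) : UniformOrder D n (fun M x => s • f M x) :=
  hf.scale hD (fun _ => s) |s| (Eventually.of_forall fun _ => le_rfl)

theorem pow_smul (hD : IsOpen D) {n : ℕ} {f : ℝ → Space d → V} (hf : UniformOrder D n f)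
    (m : ℕ) : UniformOrder D (n + m) (fun M x => M ^ m • f M x) := by
  refine hf.scale hD (fun M => M ^ m) 1 ?_
  filter_upwards [eventually_pos_lt_one] with M hM
  rw [abs_of_pos (pow_pos hM.1 m), one_mul, pow_add, mul_comm]

theorem inv_pow_smul (hD : IsOpen D) {n m : ℕ} {f : ℝ → Space d → V}
    (hf : UniformOrder D (n + m) f) : UniformOrder D n (fun M x => (M ^ m)⁻¹ • f M x) := by
  refine hf.scale hD (fun M => (M ^ m)⁻¹) 1 ?_
  filter_upwards [eventually_pos_lt_one] with M hM
  have := pow_pos hM.1 m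
  rw [abs_of_pos (inv_pos.2 this), one_mul, pow_add]
  exact le_of_eq (by field_simp)

theorem mono (hD : IsOpen D) {n m : ℕ} {f : ℝ → Space d → V} (hf : UniformOrder D n f)
    (h : m ≤ n) : UniformOrder D m f := by
  refine (hf.scale hD (m := m) (fun _ => 1) 1 ?_).congr hD
    (Eventually.of_forall fun M x _ => one_smul ℝ (f M x))
  filter_upwards [eventually_pos_lt_one] with M hM
  rw [abs_one, one_mul, one_mul]
  exact pow_le_pow_of_le_one hM.1.le hM.2.le h

theorem sub (hD : IsOpen D) {n : ℕ} {f g : ℝ → Space d → V} (hf : UniformOrder D n f)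
    (hg : UniformOrder D n g) : UniformOrder D n (fun M x => f M x - g M x) :=
  (hf.add hD (hg.const_smul hD (-1))).congr hD
    (Eventually.of_forall fun M x _ => by simp [sub_eq_add_neg])

theorem zero (n : ℕ) : UniformOrder D n (fun _ _ => (0 : V)) where
  smooth := Eventually.of_forall fun _ => contDiffOn_const
  bound j := ⟨0, Eventually.of_forall fun M x _ => by
    have : iteratedFDeriv ℝ j (fun _ : Space d => (0 : V)) = 0 := iteratedFDeriv_fun_zero
    simp [this]⟩

theorem sum (hD : IsOpen D) {ι : Type*} (s : Finset ι) {n : ℕ} {f : ι → ℝ → Space d → V}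
    (hf : ∀ i ∈ s, UniformOrder D n (f i)) :
    UniformOrder D n (fun M x => ∑ i ∈ s, f i M x) := by
  classical
  induction s using Finset.induction_on with
  | empty => simpa using zero n
  | insert i s hi ih =>
    refine ((hf i (by simp)).add hD (ih fun j hj => hf j (by simp [hj]))).congr hD
      (Eventually.of_forall fun M x _ => ?_)
    simp [Finset.sum_insert hi]

/-- Leibniz rule. Scalar multiples, inner products and the evaluation of a derivative on a velocity
are all instances of `B`, so this one estimate serves every product. -/
theorem bilin (hD : IsOpen D) (B : U →L[ℝ] V →L[ℝ] W) {n m : ℕ} {f : ℝ → Space d → U}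
    {g : ℝ → Space d → V} (hf : UniformOrder D n f) (hg : UniformOrder D m g) :
    UniformOrder D (n + m) (fun M x => B (f M x) (g M x)) where
  smooth := by
    filter_upwards [hf.smooth, hg.smooth] with M h1 h2
    exact (B.contDiff.comp_contDiffOn h1).clm_apply h2
  bound j := by
    choose C hC0 hC using fun i => hf.exists_nonneg_bound i
    choose C' hC0' hC' using fun i => hg.exists_nonneg_bound i
    refine ⟨‖B‖ * ∑ i ∈ Finset.range (j + 1), (j.choose i : ℝ) * C i * C' (j - i), ?_⟩
    have e1 : ∀ᶠ M : ℝ in 𝓝[>] 0, ∀ i ∈ Finset.range (j + 1), ∀ x ∈ D,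
        ‖iteratedFDeriv ℝ i (f M) x‖ ≤ C i * M ^ n :=
      (Finset.eventually_all _).2 fun i _ => hC i
    have e2 : ∀ᶠ M : ℝ in 𝓝[>] 0, ∀ i ∈ Finset.range (j + 1), ∀ x ∈ D,
        ‖iteratedFDeriv ℝ (j - i) (g M) x‖ ≤ C' (j - i) * M ^ m :=
      (Finset.eventually_all _).2 fun i _ => hC' (j - i)
    filter_upwards [e1, e2, hf.smooth, hg.smooth, eventually_pos_lt_one] with M h1 h2 h3 h4 h5 x hx
    have key := B.norm_iteratedFDerivWithin_le_of_bilinear h3 h4 hD.uniqueDiffOn hx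
      (n := j) (by exact_mod_cast le_top)
    simp only [iteratedFDerivWithin_of_isOpen _ hD hx] at key
    refine key.trans ?_
    rw [mul_assoc, Finset.sum_mul]
    refine mul_le_mul_of_nonneg_left (Finset.sum_le_sum fun i hi => ?_) B.opNorm_nonneg
    have hMn := (pow_pos h5.1 n).le
    calc (j.choose i : ℝ) * ‖iteratedFDeriv ℝ i (f M) x‖ * ‖iteratedFDeriv ℝ (j - i) (g M) x‖
        ≤ (j.choose i : ℝ) * (C i * M ^ n) * (C' (j - i) * M ^ m) := by
          gcongr
          · exact mul_nonneg (Nat.cast_nonneg _) (mul_nonneg (hC0 i) hMn)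
          · exact h1 i hi x hx
          · exact h2 i hi x hx
      _ = (j.choose i : ℝ) * C i * C' (j - i) * M ^ (n + m) := by ring

theorem clm (hD : IsOpen D) (L : V →L[ℝ] W) {n : ℕ} {f : ℝ → Space d → V}
    (hf : UniformOrder D n f) : UniformOrder D n (fun M x => L (f M x)) where
  smooth := by
    filter_upwards [hf.smooth] with M h1
    exact L.contDiff.comp_contDiffOn h1
  bound j := by
    obtain ⟨C, hC⟩ := hf.bound j
    refine ⟨‖L‖ * C, ?_⟩
    filter_upwards [hC, hf.smooth] with M h1 h2 x hx
    have := L.norm_iteratedFDeriv_comp_left (h2.contDiffAt (hD.mem_nhds hx))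
      (n := j) (by exact_mod_cast le_top)
    rw [mul_assoc]
    exact this.trans (mul_le_mul_of_nonneg_left (h1 x hx) L.opNorm_nonneg)

theorem fderiv (hD : IsOpen D) {n : ℕ} {f : ℝ → Space d → V} (hf : UniformOrder D n f) :
    UniformOrder D n (fun M => fderiv ℝ (f M)) where
  smooth := by
    filter_upwards [hf.smooth] with M h1
    exact h1.fderiv_of_isOpen hD (by simp)
  bound j := by
    obtain ⟨C, hC⟩ := hf.bound (j + 1)
    refine ⟨C, ?_⟩
    filter_upwards [hC] with M h1 x hx
    rw [norm_iteratedFDeriv_fderiv]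
    exact h1 x hx

theorem norm_le {n : ℕ} {f : ℝ → Space d → V} (hf : UniformOrder D n f) :
    ∃ C : ℝ, 0 ≤ C ∧ ∀ᶠ M : ℝ in 𝓝[>] 0, ∀ x ∈ D, ‖f M x‖ ≤ C * M ^ n := by
  simpa using hf.exists_nonneg_bound 0

/-- Composition with `t ↦ t⁻¹` on the open half-line `t > m`, where its `i`-th derivative is at most
`i! m⁻¹ ^ (i + 1)`. Openness of this set is the reason for the strict bound. -/
theorem inv (hD : IsOpen D) {f : ℝ → Space d → ℝ} (hf : UniformOrder D 0 f) {m : ℝ} (hm : 0 < m)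
    (hfm : ∀ᶠ M : ℝ in 𝓝[>] 0, ∀ x ∈ D, m < f M x) :
    UniformOrder D 0 (fun M x => (f M x)⁻¹) where
  smooth := by
    filter_upwards [hf.smooth, hfm] with M h1 h2
    exact h1.inv fun x hx => (hm.trans (h2 x hx)).ne'
  bound j := by
    choose C hC0 hC using fun i => hf.exists_nonneg_bound i
    have e1 : ∀ᶠ M : ℝ in 𝓝[>] 0, ∀ i ∈ Finset.range (j + 1), ∀ x ∈ D,
        ‖iteratedFDeriv ℝ i (f M) x‖ ≤ C i * M ^ 0 :=
      (Finset.eventually_all _).2 fun i _ => hC i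
    -- The composition estimate wants the `i`-th derivative bounded by `B ^ i`. Since `B ≥ 1`, any
    -- common bound for the derivatives is good enough when `i ≥ 1`.
    set B : ℝ := 1 + ∑ i ∈ Finset.range (j + 1), C i with hB
    set A : ℝ := ∑ i ∈ Finset.range (j + 1), (i.factorial : ℝ) * m⁻¹ ^ (i + 1) with hA
    have hB1 : 1 ≤ B := le_add_of_nonneg_right (Finset.sum_nonneg fun i _ => hC0 i)
    refine ⟨(j.factorial : ℝ) * A * B ^ j, ?_⟩
    filter_upwards [hf.smooth, hfm, e1] with M h1 h2 h3 x hx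
    have hinv : ContDiffOn ℝ ∞ (fun t : ℝ => t⁻¹) (Set.Ioi m) :=
      contDiffOn_id.inv fun t ht => (hm.trans ht).ne'
    have key := norm_iteratedFDerivWithin_comp_le (n := j) (C := A) (D := B) hinv h1
      (by exact_mod_cast le_top) isOpen_Ioi.uniqueDiffOn hD.uniqueDiffOn
      (fun y hy => h2 y hy) hx ?_ ?_
    · rw [iteratedFDerivWithin_of_isOpen _ hD hx] at key
      rw [pow_zero, mul_one]
      exact key
    · intro i hi
      rw [iteratedFDerivWithin_of_isOpen _ isOpen_Ioi (h2 x hx),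
        norm_iteratedFDeriv_eq_norm_iteratedDeriv, iteratedDeriv_eq_iterate]
      have h4 : 0 < f M x := hm.trans (h2 x hx)
      have h5 : deriv^[i] (fun t : ℝ => t⁻¹) (f M x) =
        (-1) ^ i * i.factorial * (f M x) ^ (-1 - i : ℤ) := iter_deriv_inv i (f M x)
      have h6 : (f M x) ^ (-1 - i : ℤ) = (f M x)⁻¹ ^ (i + 1) := by
        rw [inv_pow, ← zpow_natCast, ← zpow_neg]
        congr 1
        push_cast
        ring
      rw [h5, h6, norm_mul, norm_mul, norm_pow, norm_neg, norm_one, one_pow, one_mul,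
        norm_pow, norm_inv, Real.norm_of_nonneg h4.le, Real.norm_of_nonneg (Nat.cast_nonneg _)]
      refine le_trans ?_ (Finset.single_le_sum
        (f := fun i => (i.factorial : ℝ) * m⁻¹ ^ (i + 1)) (fun i _ => by positivity)
        (Finset.mem_range.2 (Nat.lt_succ_of_le hi)))
      have := (h2 x hx).le
      gcongr
    · intro i hi1 hi
      rw [iteratedFDerivWithin_of_isOpen _ hD hx]
      have hi' := Finset.mem_range.2 (Nat.lt_succ_of_le hi)
      calc ‖iteratedFDeriv ℝ i (f M) x‖ ≤ C i := by simpa using h3 i hi' x hx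
        _ ≤ ∑ i ∈ Finset.range (j + 1), C i := Finset.single_le_sum (fun i _ => hC0 i) hi'
        _ ≤ B := by linarith
        _ ≤ B ^ i := le_self_pow₀ hB1 (by omega)

end UniformOrder

/-- A smooth bounded field is a family of order `0` that does not depend on `M`; through this and
its converse, the closure properties of `SmoothBdd` are inherited from those of `UniformOrder`. -/
theorem SmoothBdd.uniformOrder {f : Space d → V} (hf : SmoothBdd D f) :
    UniformOrder D 0 (fun _ => f) where
  smooth := Eventually.of_forall fun _ => hf.smooth
  bound j := by
    obtain ⟨C, hC⟩ := hf.bounded j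
    exact ⟨C, Eventually.of_forall fun M x hx => by simpa using hC x hx⟩

theorem UniformOrder.smoothBdd {f : Space d → V} (hf : UniformOrder D 0 (fun _ => f)) :
    SmoothBdd D f where
  smooth := hf.smooth.exists.choose_spec
  bounded j := by
    obtain ⟨C, hC⟩ := hf.bound j
    obtain ⟨M, hM⟩ := hC.exists
    exact ⟨C, fun x hx => by simpa using hM x hx⟩

namespace SmoothBdd

theorem congr (hD : IsOpen D) {f g : Space d → V} (hf : SmoothBdd D f) (h : Set.EqOn f g D) :
    SmoothBdd D g :=
  (hf.uniformOrder.congr hD (Eventually.of_forall fun _ => h)).smoothBdd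

theorem add (hD : IsOpen D) {f g : Space d → V} (hf : SmoothBdd D f) (hg : SmoothBdd D g) :
    SmoothBdd D (fun x => f x + g x) :=
  (hf.uniformOrder.add hD hg.uniformOrder).smoothBdd

theorem sub (hD : IsOpen D) {f g : Space d → V} (hf : SmoothBdd D f) (hg : SmoothBdd D g) :
    SmoothBdd D (fun x => f x - g x) :=
  (hf.uniformOrder.sub hD hg.uniformOrder).smoothBdd

theorem const_smul (hD : IsOpen D) {f : Space d → V} (hf : SmoothBdd D f) (s : ℝ) :
    SmoothBdd D (fun x => s • f x) :=
  (hf.uniformOrder.const_smul hD s).smoothBdd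

theorem zero : SmoothBdd D (fun _ => (0 : V)) := (UniformOrder.zero 0).smoothBdd

theorem sum (hD : IsOpen D) {ι : Type*} (s : Finset ι) {f : ι → Space d → V}
    (hf : ∀ i ∈ s, SmoothBdd D (f i)) : SmoothBdd D (fun x => ∑ i ∈ s, f i x) :=
  (UniformOrder.sum hD s fun i hi => (hf i hi).uniformOrder).smoothBdd

theorem bilin (hD : IsOpen D) (B : U →L[ℝ] V →L[ℝ] W) {f : Space d → U} {g : Space d → V}
    (hf : SmoothBdd D f) (hg : SmoothBdd D g) : SmoothBdd D (fun x => B (f x) (g x)) :=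
  (hf.uniformOrder.bilin hD B hg.uniformOrder).smoothBdd

theorem clm (hD : IsOpen D) (L : V →L[ℝ] W) {f : Space d → V} (hf : SmoothBdd D f) :
    SmoothBdd D (fun x => L (f x)) :=
  (hf.uniformOrder.clm hD L).smoothBdd

theorem fderiv (hD : IsOpen D) {f : Space d → V} (hf : SmoothBdd D f) :
    SmoothBdd D (fderiv ℝ f) :=
  (hf.uniformOrder.fderiv hD).smoothBdd

theorem inv (hD : IsOpen D) {f : Space d → ℝ} (hf : SmoothBdd D f) {m : ℝ} (hm : 0 < m)
    (h : ∀ x ∈ D, m ≤ f x) : SmoothBdd D (fun x => (f x)⁻¹) :=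
  (hf.uniformOrder.inv hD (half_pos hm) (Eventually.of_forall fun _ x hx => by
    linarith [h x hx])).smoothBdd

theorem norm_le {f : Space d → V} (hf : SmoothBdd D f) : ∃ C, 0 ≤ C ∧ ∀ x ∈ D, ‖f x‖ ≤ C := by
  obtain ⟨C, hC⟩ := hf.bounded 0
  exact ⟨max C 0, le_max_right _ _, fun x hx => le_max_of_le_left (by simpa using hC x hx)⟩

theorem differentiableAt (hD : IsOpen D) {f : Space d → V} (hf : SmoothBdd D f) {x : Space d}
    (hx : x ∈ D) : DifferentiableAt ℝ f x :=
  (hf.smooth.top_contDiffAt hD hx 1).differentiableAt (by simp)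

end SmoothBdd

end UniformOrder

/-! ### The calculus of Mach number expansions -/

section Expansion

variable {d : ℕ} {D : Set (Space d)}
  {U V W : Type*} [NormedAddCommGroup U] [NormedSpace ℝ U]
  [NormedAddCommGroup V] [NormedSpace ℝ V] [NormedAddCommGroup W] [NormedSpace ℝ W]

/-- The truncated expansion `c 0 + M c 1 + ⋯ + M^N c N`. -/
def machSum (N : ℕ) (c : ℕ → Space d → V) (M : ℝ) (x : Space d) : V :=
  ∑ k ∈ Finset.range (N + 1), M ^ k • c k x

theorem uniformOrder_machSum (hD : IsOpen D) {N : ℕ} {c : ℕ → Space d → V}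
    (hc : ∀ k ≤ N, SmoothBdd D (c k)) : UniformOrder D 0 (machSum N c) :=
  UniformOrder.sum hD (Finset.range (N + 1)) (f := fun k M x => M ^ k • c k x) fun k hk =>
    ((hc k (Nat.lt_succ_iff.1 (Finset.mem_range.1 hk))).uniformOrder.pow_smul hD k).mono hD
      (Nat.zero_le _)

/-- Smoothness of the family need not be checked separately: it is the sum of a smooth remainder and
a smooth polynomial in `M`. Every expansion below is established through this criterion. -/
theorem HasMachExpansion.of_uniformOrder (hD : IsOpen D) {N : ℕ} {f : ℝ → Space d → V}
    {c : ℕ → Space d → V} (hc : ∀ k ≤ N, SmoothBdd D (c k))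
    (h : UniformOrder D (N + 1) (fun M x => f M x - machSum N c M x)) :
    HasMachExpansion D N f c where
  coeff := hc
  smooth := by
    have := ((h.mono hD (Nat.zero_le _)).add hD (uniformOrder_machSum hD hc)).smooth
    filter_upwards [this] with M hM
    simpa using hM
  remainder := h.bound

namespace HasMachExpansion

theorem uniformOrder_sub (hD : IsOpen D) {N : ℕ} {f : ℝ → Space d → V} {c : ℕ → Space d → V}
    (h : HasMachExpansion D N f c) :
    UniformOrder D (N + 1) (fun M x => f M x - machSum N c M x) where
  smooth := by
    filter_upwards [h.smooth, (uniformOrder_machSum hD h.coeff).smooth] with M h1 h2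
    exact h1.sub h2
  bound := h.remainder

theorem uniformOrder (hD : IsOpen D) {N : ℕ} {f : ℝ → Space d → V} {c : ℕ → Space d → V}
    (h : HasMachExpansion D N f c) : UniformOrder D 0 f :=
  (((h.uniformOrder_sub hD).mono hD (Nat.zero_le _)).add hD
    (uniformOrder_machSum hD h.coeff)).congr hD
    (Eventually.of_forall fun _ _ _ => sub_add_cancel _ _)

theorem congr (hD : IsOpen D) {N : ℕ} {f g : ℝ → Space d → V} {c : ℕ → Space d → V}
    (h : HasMachExpansion D N f c) (hfg : ∀ᶠ M : ℝ in 𝓝[>] 0, Set.EqOn (f M) (g M) D) :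
    HasMachExpansion D N g c :=
  of_uniformOrder hD h.coeff ((h.uniformOrder_sub hD).congr hD <| by
    filter_upwards [hfg] with M hM x hx
    simp only [hM hx])

theorem add (hD : IsOpen D) {N : ℕ} {f g : ℝ → Space d → V} {c e : ℕ → Space d → V}
    (hf : HasMachExpansion D N f c) (hg : HasMachExpansion D N g e) :
    HasMachExpansion D N (fun M x => f M x + g M x) (fun k x => c k x + e k x) :=
  of_uniformOrder hD (fun k hk => (hf.coeff k hk).add hD (hg.coeff k hk))
    (((hf.uniformOrder_sub hD).add hD (hg.uniformOrder_sub hD)).congr hD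
      (Eventually.of_forall fun M x _ => by
        simp only [machSum, smul_add, Finset.sum_add_distrib]
        abel))

theorem clm (hD : IsOpen D) (L : V →L[ℝ] W) {N : ℕ} {f : ℝ → Space d → V} {c : ℕ → Space d → V}
    (hf : HasMachExpansion D N f c) :
    HasMachExpansion D N (fun M x => L (f M x)) (fun k x => L (c k x)) :=
  of_uniformOrder hD (fun k hk => (hf.coeff k hk).clm hD L)
    (((hf.uniformOrder_sub hD).clm hD L).congr hD
      (Eventually.of_forall fun M x _ => by simp [machSum]))

theorem const_smul (hD : IsOpen D) {N : ℕ} {f : ℝ → Space d → V} {c : ℕ → Space d → V}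
    (hf : HasMachExpansion D N f c) (s : ℝ) :
    HasMachExpansion D N (fun M x => s • f M x) (fun k x => s • c k x) :=
  hf.clm hD (s • ContinuousLinearMap.id ℝ V)

theorem sub (hD : IsOpen D) {N : ℕ} {f g : ℝ → Space d → V} {c e : ℕ → Space d → V}
    (hf : HasMachExpansion D N f c) (hg : HasMachExpansion D N g e) :
    HasMachExpansion D N (fun M x => f M x - g M x) (fun k x => c k x - e k x) := by
  simpa [sub_eq_add_neg] using hf.add hD (hg.const_smul hD (-1))

theorem fderiv (hD : IsOpen D) {N : ℕ} {f : ℝ → Space d → V} {c : ℕ → Space d → V}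
    (hf : HasMachExpansion D N f c) :
    HasMachExpansion D N (fun M => fderiv ℝ (f M)) (fun k => fderiv ℝ (c k)) :=
  of_uniformOrder hD (fun k hk => (hf.coeff k hk).fderiv hD)
    (((hf.uniformOrder_sub hD).fderiv hD).congr hD (by
      filter_upwards [hf.smooth] with M hM x hx
      have hc : ∀ k ∈ Finset.range (N + 1), DifferentiableAt ℝ (fun y => M ^ k • c k y) x :=
        fun k hk => ((hf.coeff k (Nat.lt_succ_iff.1 (Finset.mem_range.1 hk))).differentiableAt
          hD hx).const_smul (M ^ k)
      have h1 : DifferentiableAt ℝ (f M) x := (hM.top_contDiffAt hD hx 1).differentiableAt (by simp)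
      have h2 : DifferentiableAt ℝ (machSum N c M) x := DifferentiableAt.fun_sum hc
      have h3 : _root_.fderiv ℝ (machSum N c M) x =
          ∑ k ∈ Finset.range (N + 1), M ^ k • _root_.fderiv ℝ (c k) x := by
        refine (fderiv_fun_sum hc).trans (Finset.sum_congr rfl fun k hk => ?_)
        exact fderiv_fun_const_smul
          ((hf.coeff k (Nat.lt_succ_iff.1 (Finset.mem_range.1 hk))).differentiableAt hD hx) _
      simp only [fderiv_fun_sub h1 h2, h3]
      rfl))

theorem _root_.LowMach.SmoothBdd.hasMachExpansion (hD : IsOpen D) {g : Space d → V}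
    (hg : SmoothBdd D g) (N : ℕ) :
    HasMachExpansion D N (fun _ => g) (fun k x => if k = 0 then g x else 0) :=
  of_uniformOrder hD
    (fun k _ => by
      by_cases h : k = 0
      · simpa [h] using hg
      · simpa [h] using SmoothBdd.zero)
    ((UniformOrder.zero (N + 1)).congr hD (Eventually.of_forall fun M x _ => by
      simp [machSum]))

theorem congr_coeff (hD : IsOpen D) {N : ℕ} {f : ℝ → Space d → V} {c e : ℕ → Space d → V}
    (h : HasMachExpansion D N f c) (hce : ∀ k ≤ N, Set.EqOn (c k) (e k) D) :
    HasMachExpansion D N f e :=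
  of_uniformOrder hD (fun k hk => (h.coeff k hk).congr hD (hce k hk))
    ((h.uniformOrder_sub hD).congr hD (Eventually.of_forall fun M x hx => by
      simp only [machSum]
      congr 1
      exact Finset.sum_congr rfl fun k hk => by
        rw [hce k (Nat.lt_succ_iff.1 (Finset.mem_range.1 hk)) hx]))

theorem shift (hD : IsOpen D) {N : ℕ} {f : ℝ → Space d → V} {c : ℕ → Space d → V}
    (h : HasMachExpansion D N f c) (m : ℕ) :
    HasMachExpansion D (N + m) (fun M x => M ^ m • f M x)
      (fun k x => if k < m then 0 else c (k - m) x) := by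
  refine of_uniformOrder hD (fun k hk => ?_) ?_
  · by_cases hkm : k < m
    · simpa [hkm] using SmoothBdd.zero
    · simpa [hkm] using h.coeff (k - m) (by omega)
  · have := (h.uniformOrder_sub hD).pow_smul hD m
    rw [show N + 1 + m = N + m + 1 by ring] at this
    refine this.congr hD (Eventually.of_forall fun M x _ => ?_)
    simp only [machSum]
    rw [show N + m + 1 = m + (N + 1) by ring, Finset.sum_range_add _ m (N + 1), smul_sub]
    rw [Finset.sum_eq_zero (s := Finset.range m) fun k hk => by
      simp [Finset.mem_range.1 hk], zero_add, Finset.smul_sum]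
    simp [pow_add, mul_smul]

/-- Division by `M ^ m` is legitimate once the first `m` coefficients vanish, and costs `m` orders.
It gives a meaning to the `M⁻²` terms of the scheme. -/
theorem unshift (hD : IsOpen D) {N m : ℕ} {f : ℝ → Space d → V} {c : ℕ → Space d → V}
    (h : HasMachExpansion D (N + m) f c) (hc : ∀ k < m, ∀ x ∈ D, c k x = 0) :
    HasMachExpansion D N (fun M x => (M ^ m)⁻¹ • f M x) (fun k => c (k + m)) := by
  refine of_uniformOrder hD (fun k hk => h.coeff (k + m) (by omega)) ?_
  have := h.uniformOrder_sub hD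
  rw [show N + m + 1 = N + 1 + m by ring] at this
  refine (this.inv_pow_smul hD).congr hD ?_
  filter_upwards [eventually_pos_lt_one] with M hM x hx
  simp only [machSum]
  rw [show N + m + 1 = m + (N + 1) by ring, Finset.sum_range_add, smul_sub]
  rw [Finset.sum_eq_zero (s := Finset.range m) fun k hk => by
      rw [hc k (Finset.mem_range.1 hk) x hx, smul_zero], zero_add, Finset.smul_sum]
  congr 1
  refine Finset.sum_congr rfl fun k _ => ?_
  rw [smul_smul, pow_add, inv_mul_cancel_left₀ (pow_pos hM.1 m).ne', add_comm m k]

theorem truncate (hD : IsOpen D) {N N' : ℕ} {f : ℝ → Space d → V} {c : ℕ → Space d → V}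
    (h : HasMachExpansion D N f c) (hN : N' ≤ N) : HasMachExpansion D N' f c := by
  refine of_uniformOrder hD (fun k hk => h.coeff k (hk.trans hN)) ?_
  have h1 : UniformOrder D (N' + 1)
      (fun M x => ∑ k ∈ Finset.Ico (N' + 1) (N + 1), M ^ k • c k x) :=
    UniformOrder.sum hD _ (f := fun k M x => M ^ k • c k x) fun k hk => by
      have hk' := Finset.mem_Ico.1 hk
      exact ((h.coeff k (by omega)).uniformOrder.pow_smul hD k).mono hD (by omega)
  refine (((h.uniformOrder_sub hD).mono hD (Nat.succ_le_succ hN)).add hD h1).congr hD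
    (Eventually.of_forall fun M x _ => ?_)
  simp only [machSum]
  rw [← Finset.sum_range_add_sum_Ico (fun k => M ^ k • c k x) (Nat.succ_le_succ hN)]
  abel

/-- Cauchy product. The remainder has three parts: the remainder of `f` against `g`, the truncation
of `f` against the remainder of `g`, and the products of coefficients of total degree above `N`. -/
theorem bilin (hD : IsOpen D) (B : U →L[ℝ] V →L[ℝ] W) {N : ℕ} {f : ℝ → Space d → U}
    {g : ℝ → Space d → V} {c : ℕ → Space d → U} {e : ℕ → Space d → V}
    (hf : HasMachExpansion D N f c) (hg : HasMachExpansion D N g e) :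
    HasMachExpansion D N (fun M x => B (f M x) (g M x))
      (fun k x => ∑ ij ∈ Finset.HasAntidiagonal.antidiagonal k, B (c ij.1 x) (e ij.2 x)) := by
  refine of_uniformOrder hD (fun k hk => SmoothBdd.sum hD _ fun ij hij => ?_) ?_
  · have := Finset.HasAntidiagonal.mem_antidiagonal.1 hij
    exact (hf.coeff ij.1 (by omega)).bilin hD B (hg.coeff ij.2 (by omega))
  set R := Finset.range (N + 1)
  have h1 : UniformOrder D (N + 1) (fun M x => B (f M x - machSum N c M x) (g M x)) :=
    (hf.uniformOrder_sub hD).bilin hD B (hg.uniformOrder hD)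
  have h2 : UniformOrder D (N + 1) (fun M x => B (machSum N c M x) (g M x - machSum N e M x)) :=
    ((uniformOrder_machSum hD hf.coeff).bilin hD B (hg.uniformOrder_sub hD)).mono hD (by omega)
  have h3 : UniformOrder D (N + 1)
      (fun M x => ∑ ij ∈ (R ×ˢ R).filter (fun ij => ¬ ij.1 + ij.2 < N + 1),
        M ^ (ij.1 + ij.2) • B (c ij.1 x) (e ij.2 x)) :=
    UniformOrder.sum hD _ (f := fun (ij : ℕ × ℕ) M x => M ^ (ij.1 + ij.2) • B (c ij.1 x) (e ij.2 x))
      fun ij hij => by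
        simp only [R, Finset.mem_filter, Finset.mem_product, Finset.mem_range] at hij
        exact (((hf.coeff ij.1 (by omega)).bilin hD B
          (hg.coeff ij.2 (by omega))).uniformOrder.pow_smul hD (ij.1 + ij.2)).mono hD (by omega)
  refine ((h1.add hD h2).add hD h3).congr hD (Eventually.of_forall fun M x _ => ?_)
  have hprod : B (machSum N c M x) (machSum N e M x) =
      ∑ ij ∈ R ×ˢ R, M ^ (ij.1 + ij.2) • B (c ij.1 x) (e ij.2 x) := by
    simp only [machSum, map_sum, _root_.sum_apply, map_smul, smul_apply,
      Finset.sum_product, R, pow_add, mul_smul]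
    rw [Finset.sum_comm]
    refine Finset.sum_congr rfl fun j _ => ?_
    rw [Finset.smul_sum]
    exact Finset.sum_congr rfl fun i _ => smul_comm _ _ _
  have hlow : machSum N (fun k x => ∑ ij ∈ Finset.HasAntidiagonal.antidiagonal k, B (c ij.1 x) (e ij.2 x)) M x =
      ∑ ij ∈ (R ×ˢ R).filter (fun ij => ij.1 + ij.2 < N + 1),
        M ^ (ij.1 + ij.2) • B (c ij.1 x) (e ij.2 x) := by
    rw [← Finset.sum_fiberwise_of_maps_to (s := (R ×ˢ R).filter _) (t := R)
      (g := fun ij : ℕ × ℕ => ij.1 + ij.2)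
      fun ij hij => Finset.mem_range.2 (Finset.mem_filter.1 hij).2]
    refine Finset.sum_congr rfl fun k hk => ?_
    have hk' := Finset.mem_range.1 hk
    rw [Finset.smul_sum]
    refine Finset.sum_congr ?_ fun ij hij => ?_
    · ext ij
      simp only [R, Finset.mem_filter, Finset.mem_product, Finset.mem_range,
        Finset.HasAntidiagonal.mem_antidiagonal]
      omega
    · rw [(Finset.mem_filter.1 hij).2]
  have hsplit := Finset.sum_filter_add_sum_filter_not (R ×ˢ R)
    (fun ij : ℕ × ℕ => ij.1 + ij.2 < N + 1) fun ij : ℕ × ℕ => M ^ (ij.1 + ij.2) • B (c ij.1 x) (e ij.2 x)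
  rw [← hprod, ← hlow] at hsplit
  simp only [map_sub, _root_.sub_apply]
  rw [← hsplit]
  abel

/-- Letting `M → 0` gives `e 0 = 0`; dividing by `M` then lowers the degree by one. -/
theorem eq_zero_of_isBigO {N : ℕ} {e : ℕ → V} {C : ℝ}
    (h : ∀ᶠ M : ℝ in 𝓝[>] 0, ‖∑ k ∈ Finset.range (N + 1), M ^ k • e k‖ ≤ C * M ^ (N + 1)) :
    ∀ k ≤ N, e k = 0 := by
  induction N generalizing e with
  | zero =>
    intro k hk
    obtain rfl : k = 0 := by omega
    have h1 : Tendsto (fun M : ℝ => C * M ^ (0 + 1)) (𝓝[>] 0) (𝓝 0) := by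
      have : Tendsto (fun M : ℝ => C * M ^ (0 + 1)) (𝓝 0) (𝓝 (C * 0 ^ (0 + 1))) :=
        Continuous.tendsto (by fun_prop) _
      simpa using this.mono_left nhdsWithin_le_nhds
    have := ge_of_tendsto h1 (by simpa using h)
    simpa using this
  | succ N ih =>
    have h0 : e 0 = 0 := by
      have h1 : Tendsto (fun M : ℝ => C * M ^ (N + 1 + 1)) (𝓝[>] 0) (𝓝 0) := by
        have : Tendsto (fun M : ℝ => C * M ^ (N + 1 + 1)) (𝓝 0) (𝓝 (C * 0 ^ (N + 1 + 1))) :=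
          Continuous.tendsto (by fun_prop) _
        simpa using this.mono_left nhdsWithin_le_nhds
      have h2 : Tendsto (fun M : ℝ => ‖∑ k ∈ Finset.range (N + 1 + 1), M ^ k • e k‖)
          (𝓝[>] 0) (𝓝 ‖e 0‖) := by
        have : Tendsto (fun M : ℝ => ‖∑ k ∈ Finset.range (N + 1 + 1), M ^ k • e k‖)
          (𝓝 0) (𝓝 ‖∑ k ∈ Finset.range (N + 1 + 1), (0 : ℝ) ^ k • e k‖) :=
          Continuous.tendsto (by fun_prop) _
        rw [Finset.sum_range_succ'] at this
        simpa using this.mono_left nhdsWithin_le_nhds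
      exact norm_le_zero_iff.1 (le_of_tendsto_of_tendsto h2 h1 h)
    have h1 : ∀ k ≤ N, e (k + 1) = 0 := by
      refine ih (e := fun k => e (k + 1)) ?_
      filter_upwards [h, eventually_pos_lt_one] with M h1 h2
      rw [Finset.sum_range_succ', h0, smul_zero, add_zero] at h1
      have h3 : ∑ k ∈ Finset.range (N + 1), M ^ (k + 1) • e (k + 1) =
          M • ∑ k ∈ Finset.range (N + 1), M ^ k • e (k + 1) := by
        rw [Finset.smul_sum]
        exact Finset.sum_congr rfl fun k _ => by rw [smul_smul, pow_succ']
      rw [h3, norm_smul, Real.norm_of_nonneg h2.1.le, pow_succ' M (N + 1)] at h1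
      refine le_of_mul_le_mul_left ?_ h2.1
      calc _ ≤ _ := h1
        _ = _ := by ring
    rintro (_ | k) hk
    · exact h0
    · exact h1 k (by omega)

/-- This turns an identity between families into identities between their coefficients. -/
theorem unique (hD : IsOpen D) {N : ℕ} {f : ℝ → Space d → V} {c e : ℕ → Space d → V}
    (hc : HasMachExpansion D N f c) (he : HasMachExpansion D N f e) :
    ∀ k ≤ N, ∀ x ∈ D, c k x = e k x := by
  intro k hk x hx
  have h := (hc.uniformOrder_sub hD).sub hD (he.uniformOrder_sub hD)
  obtain ⟨C, _, hC⟩ := h.norm_le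
  refine sub_eq_zero.1 (eq_zero_of_isBigO (N := N) (e := fun k => c k x - e k x) (C := C) ?_ k hk)
  filter_upwards [hC] with M hM
  refine le_trans (le_of_eq ?_) (hM x hx)
  rw [← norm_neg]
  congr 1
  simp only [machSum, smul_sub, Finset.sum_sub_distrib]
  abel

/-- Division by a family of scalar functions with invertible leading coefficient. -/
theorem exists_inv_smul (hD : IsOpen D) {N : ℕ} {f : ℝ → Space d → V} {c : ℕ → Space d → V}
    {r : ℝ → Space d → ℝ} {b : ℕ → Space d → ℝ} (hf : HasMachExpansion D N f c)
    (hr : HasMachExpansion D N r b) {m : ℝ} (hm : 0 < m)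
    (hrm : ∀ᶠ M : ℝ in 𝓝[>] 0, ∀ x ∈ D, m < r M x) (hbm : ∀ x ∈ D, m ≤ b 0 x) :
    ∃ h, HasMachExpansion D N (fun M x => (r M x)⁻¹ • f M x) h := by
  have hri := (hr.uniformOrder hD).inv hD hm hrm
  have hb0 : SmoothBdd D (b 0) := hr.coeff 0 (Nat.zero_le _)
  -- With `h₀ = c₀ / b₀`, the difference `f - r h₀` has no leading term. It is `O(M)` if `N = 0`;
  -- otherwise it is divided by `M` and the induction hypothesis applies, since `r⁻¹ f = h₀ + M r⁻¹
  -- (M⁻¹ (f - r h₀))`. The coefficients of the quotient need no formula: uniqueness recovers them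
  -- from the product with `r`.
  induction N generalizing f c with
  | zero =>
    have hh : SmoothBdd D (fun x => (b 0 x)⁻¹ • c 0 x) :=
      (hb0.inv hD hm hbm).bilin hD (ContinuousLinearMap.lsmul ℝ ℝ) (hf.coeff 0 le_rfl)
    refine ⟨fun _ x => (b 0 x)⁻¹ • c 0 x, of_uniformOrder hD (fun _ _ => hh) ?_⟩
    have h1 := (hf.uniformOrder_sub hD).sub hD
      ((hr.uniformOrder_sub hD).bilin hD (ContinuousLinearMap.lsmul ℝ ℝ) hh.uniformOrder)
    refine (hri.bilin hD (ContinuousLinearMap.lsmul ℝ ℝ) h1 |>.mono hD (by omega)).congr hD ?_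
    filter_upwards [hrm] with M hM x hx
    have h2 : r M x ≠ 0 := (hm.trans (hM x hx)).ne'
    have h3 : b 0 x ≠ 0 := (hm.trans_le (hbm x hx)).ne'
    simp only [machSum, ContinuousLinearMap.lsmul_apply, Finset.sum_range_one, pow_zero, one_smul,
      zero_add, smul_sub, sub_smul, smul_eq_mul, one_mul]
    rw [smul_smul (r M x), smul_smul (r M x)⁻¹ (r M x * _), inv_mul_cancel_left₀ h2,
      smul_smul (b 0 x), mul_inv_cancel₀ h3, one_smul]
    abel
  | succ N ih =>
    have hh : SmoothBdd D (fun x => (b 0 x)⁻¹ • c 0 x) :=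
      (hb0.inv hD hm hbm).bilin hD (ContinuousLinearMap.lsmul ℝ ℝ) (hf.coeff 0 (Nat.zero_le _))
    have h1 := hf.sub hD (hr.bilin hD (ContinuousLinearMap.lsmul ℝ ℝ)
      (hh.hasMachExpansion hD (N + 1)))
    have h2 := h1.unshift hD (m := 1) (fun k hk x hx => by
      obtain rfl : k = 0 := by omega
      have h3 : b 0 x ≠ 0 := (hm.trans_le (hbm x hx)).ne'
      simp [smul_smul, mul_inv_cancel₀ h3])
    obtain ⟨h, hh'⟩ := ih h2 (hr.truncate hD (Nat.le_succ N))
    refine ⟨_, ((hh'.shift hD 1).add hD (hh.hasMachExpansion hD (N + 1))).congr hD ?_⟩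
    filter_upwards [hrm, eventually_pos_lt_one] with M hM hM0 x hx
    have h2 : r M x ≠ 0 := (hm.trans (hM x hx)).ne'
    have h3 : b 0 x ≠ 0 := (hm.trans_le (hbm x hx)).ne'
    simp only [ContinuousLinearMap.lsmul_apply, pow_one]
    rw [smul_comm (r M x)⁻¹ M⁻¹, smul_inv_smul₀ hM0.1.ne', smul_sub, inv_smul_smul₀ h2,
      sub_add_cancel]

end HasMachExpansion

end Expansion

/-! ### Divergence and gradient -/

section Operators

variable {d : ℕ} {D : Set (Space d)}

/-- The trace of a linear map, as a continuous linear functional. -/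
def traceCLM (d : ℕ) : (Space d →L[ℝ] Space d) →L[ℝ] ℝ :=
  ∑ i, (EuclideanSpace.proj i : Space d →L[ℝ] ℝ) ∘L
    ContinuousLinearMap.apply ℝ (Space d) (EuclideanSpace.single i (1 : ℝ))

/-- The Riesz representation of a linear functional, as a real continuous linear map. -/
def rieszCLM (d : ℕ) : (Space d →L[ℝ] ℝ) →L[ℝ] Space d :=
  LinearMap.toContinuousLinearMap
    { toFun := fun l => (InnerProductSpace.toDual ℝ (Space d)).symm l
      map_add' := fun l l' => map_add _ l l'
      map_smul' := fun c l => by simp }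

theorem divg_eq (V : Space d → Space d) (x : Space d) : divg V x = traceCLM d (fderiv ℝ V x) := by
  simp [divg, traceCLM]

theorem gradient_eq (f : Space d → ℝ) (x : Space d) :
    gradient f x = rieszCLM d (fderiv ℝ f x) := rfl

theorem inner_gradient (f : Space d → ℝ) (x v : Space d) :
    inner ℝ (gradient f x) v = fderiv ℝ f x v := by
  simp [gradient]

theorem traceCLM_smulRight (l : Space d →L[ℝ] ℝ) (v : Space d) :
    traceCLM d (l.smulRight v) = l v := by
  have h : v = ∑ i, v i • EuclideanSpace.single i (1 : ℝ) := by
    ext j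
    simp [Finset.sum_apply, Pi.single_apply]
  conv_rhs => rw [h]
  simp [traceCLM, mul_comm]

theorem fderiv_congr_on (hD : IsOpen D) {V : Type*} [NormedAddCommGroup V] [NormedSpace ℝ V]
    {f g : Space d → V} (h : Set.EqOn f g D) {x : Space d} (hx : x ∈ D) :
    fderiv ℝ f x = fderiv ℝ g x :=
  (h.eventuallyEq_of_mem (hD.mem_nhds hx)).fderiv_eq

theorem divg_congr_on (hD : IsOpen D) {V W : Space d → Space d} (h : Set.EqOn V W D) {x : Space d}
    (hx : x ∈ D) : divg V x = divg W x := by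
  rw [divg_eq, divg_eq, fderiv_congr_on hD h hx]

theorem gradient_congr_on (hD : IsOpen D) {f g : Space d → ℝ} (h : Set.EqOn f g D) {x : Space d}
    (hx : x ∈ D) : gradient f x = gradient g x := by
  rw [gradient_eq, gradient_eq, fderiv_congr_on hD h hx]

theorem divg_add {V W : Space d → Space d} {x : Space d} (hV : DifferentiableAt ℝ V x)
    (hW : DifferentiableAt ℝ W x) : divg (fun y => V y + W y) x = divg V x + divg W x := by
  simp only [divg_eq, fderiv_fun_add hV hW, map_add]

theorem divg_sub {V W : Space d → Space d} {x : Space d} (hV : DifferentiableAt ℝ V x)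
    (hW : DifferentiableAt ℝ W x) : divg (fun y => V y - W y) x = divg V x - divg W x := by
  simp only [divg_eq, fderiv_fun_sub hV hW, map_sub]

theorem divg_const_smul {V : Space d → Space d} {x : Space d} (hV : DifferentiableAt ℝ V x)
    (c : ℝ) : divg (fun y => c • V y) x = c * divg V x := by
  simp only [divg_eq, fderiv_fun_const_smul hV, map_smul, smul_eq_mul]

theorem divg_zero (x : Space d) : divg (fun _ : Space d => (0 : Space d)) x = 0 := by
  simp [divg]

theorem divg_smul {f : Space d → ℝ} {V : Space d → Space d} {x : Space d}
    (hf : DifferentiableAt ℝ f x) (hV : DifferentiableAt ℝ V x) :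
    divg (fun y => f y • V y) x = f x * divg V x + fderiv ℝ f x (V x) := by
  simp only [divg_eq, fderiv_fun_smul hf hV, map_add, map_smul, smul_eq_mul, traceCLM_smulRight]

theorem gradient_add {f g : Space d → ℝ} {x : Space d} (hf : DifferentiableAt ℝ f x)
    (hg : DifferentiableAt ℝ g x) :
    gradient (fun y => f y + g y) x = gradient f x + gradient g x := by
  simp only [gradient_eq, fderiv_fun_add hf hg, map_add]

theorem gradient_sub {f g : Space d → ℝ} {x : Space d} (hf : DifferentiableAt ℝ f x)
    (hg : DifferentiableAt ℝ g x) :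
    gradient (fun y => f y - g y) x = gradient f x - gradient g x := by
  simp only [gradient_eq, fderiv_fun_sub hf hg, map_sub]

theorem gradient_const_mul {f : Space d → ℝ} {x : Space d} (hf : DifferentiableAt ℝ f x) (c : ℝ) :
    gradient (fun y => c * f y) x = c • gradient f x := by
  have : fderiv ℝ (fun y => c * f y) x = c • fderiv ℝ f x := fderiv_const_mul hf c
  simp only [gradient_eq, this, map_smul]

theorem SmoothBdd.divg (hD : IsOpen D) {V : Space d → Space d} (hV : SmoothBdd D V) :
    SmoothBdd D (divg V) :=
  ((hV.fderiv hD).clm hD (traceCLM d)).congr hD fun x _ => (divg_eq V x).symm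

theorem SmoothBdd.gradient (hD : IsOpen D) {f : Space d → ℝ} (hf : SmoothBdd D f) :
    SmoothBdd D (gradient f) :=
  (hf.fderiv hD).clm hD (rieszCLM d)

theorem SmoothBdd.smul (hD : IsOpen D) {V : Type*} [NormedAddCommGroup V] [NormedSpace ℝ V]
    {f : Space d → ℝ} {g : Space d → V} (hf : SmoothBdd D f) (hg : SmoothBdd D g) :
    SmoothBdd D (fun x => f x • g x) :=
  hf.bilin hD (ContinuousLinearMap.lsmul ℝ ℝ) hg

theorem SmoothBdd.mul (hD : IsOpen D) {f g : Space d → ℝ} (hf : SmoothBdd D f)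
    (hg : SmoothBdd D g) : SmoothBdd D (fun x => f x * g x) :=
  hf.smul hD hg

theorem SmoothBdd.inner (hD : IsOpen D) {f g : Space d → Space d} (hf : SmoothBdd D f)
    (hg : SmoothBdd D g) : SmoothBdd D (fun x => inner ℝ (f x) (g x)) :=
  hf.bilin hD (innerSL ℝ) hg

theorem SmoothBdd.advect (hD : IsOpen D) {u v : Space d → Space d} (hu : SmoothBdd D u)
    (hv : SmoothBdd D v) : SmoothBdd D (advect u v) :=
  (hv.fderiv hD).bilin hD (ContinuousLinearMap.id ℝ _) hu

end Operators

/-! ### The divergence theorem and its consequences -/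

section Integral

open MeasureTheory

variable {d : ℕ} {D : Set (Space d)}

theorem contDiff_of_eq_zero_off_compact (hD : IsOpen D) {K : Set (Space d)} (hK : IsCompact K)
    (hKD : K ⊆ D) {V : Space d → Space d} (hV : ContDiffOn ℝ 1 V D) (hV0 : ∀ x ∉ K, V x = 0) :
    ContDiff ℝ 1 V := by
  refine contDiff_iff_contDiffAt.2 fun x => ?_
  by_cases hx : x ∈ K
  · exact hV.contDiffAt (hD.mem_nhds (hKD hx))
  · refine (contDiffAt_const (c := (0 : Space d))).congr_of_eventuallyEq ?_
    filter_upwards [hK.isClosed.isOpen_compl.mem_nhds hx] with y hy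
    exact hV0 y hy

theorem continuous_divg {V : Space d → Space d} (hV : ContDiff ℝ 1 V) : Continuous (divg V) := by
  have : divg V = fun x => traceCLM d (fderiv ℝ V x) := funext (divg_eq V)
  rw [this]
  exact (traceCLM d).continuous.comp (hV.continuous_fderiv (by simp))

theorem divg_eq_zero_off_compact {K : Set (Space d)} (hK : IsCompact K) {V : Space d → Space d}
    (hV0 : ∀ x ∉ K, V x = 0) {x : Space d} (hx : x ∉ K) : divg V x = 0 := by
  rw [divg_congr_on hK.isClosed.isOpen_compl (fun y hy => hV0 y hy) hx]
  exact divg_zero x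

/-- Integration by parts against the constant `1` shows that every directional derivative of `V` has
integral zero. Only compactly supported fields are integrated, so the boundary of `D` never enters.
-/
theorem integral_divg_eq_zero {K : Set (Space d)} (hK : IsCompact K) {V : Space d → Space d}
    (hV : ContDiff ℝ 1 V) (hV0 : ∀ x ∉ K, V x = 0) : ∫ x, divg V x = 0 := by
  have hs : HasCompactSupport V := HasCompactSupport.intro hK hV0
  have hint : ∀ v : Space d, Integrable fun x => fderiv ℝ V x v := fun v =>
    ((hV.continuous_fderiv (by simp)).clm_apply continuous_const).integrable_of_hasCompactSupport
      (hs.fderiv_apply ℝ v)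
  have hz : ∀ v : Space d, ∫ x, fderiv ℝ V x v = 0 := fun v => by
    have := integral_smul_fderiv_eq_neg_fderiv_smul_of_integrable (μ := volume) (𝕜 := ℝ)
      (f := fun _ : Space d => (1 : ℝ)) (g := V) (v := v) (by simp) (by simpa using hint v)
      (by simpa using hV.continuous.integrable_of_hasCompactSupport hs)
      (fun x _ => differentiableAt_const _) (fun x _ => hV.differentiable (by simp) x)
    simpa using this
  unfold divg
  refine (integral_finsetSum _ fun i _ => (EuclideanSpace.proj i : Space d →L[ℝ] ℝ).integrable_comp
    (hint (EuclideanSpace.single i 1))).trans (Finset.sum_eq_zero fun i _ => ?_)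
  have := (EuclideanSpace.proj i : Space d →L[ℝ] ℝ).integral_comp_comm
    (hint (EuclideanSpace.single i 1))
  rw [hz] at this
  simpa using this

/-- A bounded vector field whose divergence is `κ` times a positive density has a small `κ`. -/
theorem exists_bound_of_divg_eq (hD : IsOpen D) (hne : D.Nonempty) {m : ℝ} (hm : 0 < m) :
    ∃ C, 0 ≤ C ∧ ∀ (X : Space d → Space d) (r : Space d → ℝ) (κ B : ℝ), SmoothBdd D X →
      (∀ x ∈ D, ‖X x‖ ≤ B) → (∀ x ∈ D, m ≤ r x) → (∀ x ∈ D, divg X x = κ * r x) →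
      |κ| ≤ C * B := by
  obtain ⟨x₀, hx₀⟩ := hne
  obtain ⟨ε, hε, hball⟩ := Metric.isOpen_iff.1 hD x₀ hx₀
  -- The bump is fixed once and for all, so the constant `∫ ‖∇φ‖ / (m ∫ φ)` depends on neither `X`,
  -- `r` nor `κ`.
  let φ : ContDiffBump x₀ := ⟨ε / 4, ε / 2, by positivity, by linarith⟩
  have hφ : ContDiff ℝ 1 φ := φ.contDiff
  have hφs : HasCompactSupport φ := φ.hasCompactSupport
  have hK : IsCompact (Metric.closedBall x₀ (ε / 2)) := isCompact_closedBall _ _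
  have hKD : Metric.closedBall x₀ (ε / 2) ⊆ D :=
    (Metric.closedBall_subset_ball (by linarith)).trans hball
  have hφ0 : ∀ x ∉ Metric.closedBall x₀ (ε / 2), φ x = 0 := fun x hx =>
    φ.zero_of_le_dist (le_of_lt (by simpa using hx))
  have hI : 0 < ∫ x, φ x := φ.integral_pos
  set J := ∫ x, ‖fderiv ℝ φ x‖ with hJ
  have hint1 : Integrable fun x => φ x := hφ.continuous.integrable_of_hasCompactSupport hφs
  have hint2 : Integrable fun x => ‖fderiv ℝ φ x‖ :=
    ((hφ.continuous_fderiv (by simp)).integrable_of_hasCompactSupport (hφs.fderiv ℝ)).norm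
  have hJ0 : 0 ≤ J := integral_nonneg fun _ => norm_nonneg _
  -- For `κ ≥ 0`, integrating `∇·(φ X) = κ φ r + ∇φ · X` gives `0 ≥ κ m ∫ φ - B ∫ ‖∇φ‖`. Negative
  -- `κ` is treated by replacing `X` with `-X`.
  have key : ∀ (X : Space d → Space d) (r : Space d → ℝ) (κ B : ℝ), 0 ≤ κ → SmoothBdd D X →
      (∀ x ∈ D, ‖X x‖ ≤ B) → (∀ x ∈ D, m ≤ r x) → (∀ x ∈ D, divg X x = κ * r x) →
      κ ≤ J / (m * ∫ x, φ x) * B := by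
    intro X r κ B hκ hX hB hr hdiv
    have hV0 : ∀ x ∉ Metric.closedBall x₀ (ε / 2), φ x • X x = 0 := fun x hx => by
      rw [hφ0 x hx, zero_smul]
    have hV : ContDiff ℝ 1 (fun x => φ x • X x) :=
      contDiff_of_eq_zero_off_compact hD hK hKD
        (hφ.contDiffOn.smul (hX.smooth.of_le (by exact_mod_cast le_top))) hV0
    have h0 := integral_divg_eq_zero hK hV hV0
    have hB0 : 0 ≤ B := (norm_nonneg _).trans (hB x₀ hx₀)
    have hle : ∫ x, (κ * m * φ x - B * ‖fderiv ℝ φ x‖) ≤ ∫ x, divg (fun x => φ x • X x) x := by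
      refine integral_mono ((hint1.const_mul _).sub (hint2.const_mul _)) ?_ fun x => ?_
      · exact (continuous_divg hV).integrable_of_hasCompactSupport
          (HasCompactSupport.intro hK fun x hx => divg_eq_zero_off_compact hK hV0 hx)
      · by_cases hx : x ∈ Metric.closedBall x₀ (ε / 2)
        · have hxD := hKD hx
          change κ * m * φ x - B * ‖fderiv ℝ φ x‖ ≤ _
          rw [divg_smul (hφ.differentiable (by simp) x) (hX.differentiableAt hD hxD),
            hdiv x hxD]
          have h1 : |fderiv ℝ φ x (X x)| ≤ ‖fderiv ℝ φ x‖ * B :=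
            ((fderiv ℝ φ x).le_opNorm (X x)).trans
              (mul_le_mul_of_nonneg_left (hB x hxD) (norm_nonneg _))
          have h2 : κ * m * φ x ≤ φ x * (κ * r x) := by
            have := mul_le_mul_of_nonneg_left (hr x hxD) (mul_nonneg hκ (φ.nonneg (x := x)))
            linarith
          linarith [neg_abs_le (fderiv ℝ φ x (X x))]
        · change κ * m * φ x - B * ‖fderiv ℝ φ x‖ ≤ _
          rw [divg_eq_zero_off_compact hK hV0 hx, hφ0 x hx]
          have := mul_nonneg hB0 (norm_nonneg (fderiv ℝ φ x))
          linarith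
    rw [h0, integral_sub (hint1.const_mul _) (hint2.const_mul _), integral_const_mul,
      integral_const_mul, ← hJ] at hle
    rw [div_mul_eq_mul_div, le_div_iff₀ (by positivity)]
    linarith
  refine ⟨J / (m * ∫ x, φ x), by positivity, fun X r κ B hX hB hr hdiv => ?_⟩
  rcases le_total 0 κ with h | h
  · rw [abs_of_nonneg h]
    exact key X r κ B h hX hB hr hdiv
  · rw [abs_of_nonpos h]
    refine key (fun x => (-1 : ℝ) • X x) r (-κ) B (by linarith) (hX.const_smul hD (-1))
      (fun x hx => by simpa using hB x hx) hr fun x hx => ?_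
    rw [divg_const_smul (hX.differentiableAt hD hx), hdiv x hx]
    ring

/-- The energy argument for `∇ · (r ∇f) = 0`: if `∇f` vanishes on the boundary of a bounded open
set, then it vanishes. -/
theorem gradient_eq_zero_of_divg_eq_zero (hD : IsOpen D) (hb : Bornology.IsBounded D)
    {f r : Space d → ℝ} (hf : SmoothBdd D f) (hr : SmoothBdd D r) (hr0 : ∀ x ∈ D, 0 < r x)
    (hdiv : ∀ x ∈ D, divg (fun y => r y • gradient f y) x = 0)
    (hbc : ∀ y ∈ frontier D, Tendsto (gradient f) (𝓝[D] y) (𝓝 0)) :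
    ∀ x ∈ D, gradient f x = 0 := by
  have hG : SmoothBdd D (gradient f) := hf.gradient hD
  have hV : SmoothBdd D (fun y => r y • gradient f y) := hr.smul hD hG
  set g : Space d → ℝ := fun x => inner ℝ (gradient f x) (gradient f x) with hg
  have hgs : SmoothBdd D g := hG.inner hD hG
  have hg0 : ∀ x, 0 ≤ g x := fun x => real_inner_self_nonneg
  -- The cutoff is taken in the values of `g = |∇f|²`, not in the distance to the boundary: `χ (n
  -- g)` vanishes where `n g < 1`, which includes a neighbourhood of `∂D` in `D`, and equals `1`
  -- where `n g ≥ 2`.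
  set χ : ℝ → ℝ := fun t => Real.smoothTransition (t - 1) with hχ
  have hχs : ContDiff ℝ 1 χ := Real.smoothTransition.contDiff.comp (contDiff_id.sub contDiff_const)
  have hχ0 : ∀ t < 1, χ t = 0 := fun t ht =>
    Real.smoothTransition.zero_of_nonpos (by linarith)
  have hχ1 : ∀ t ≥ 2, χ t = 1 := fun t ht => Real.smoothTransition.one_of_one_le (by linarith)
  have hχd : ∀ t > 2, deriv χ t = 0 := fun t ht => by
    have : χ =ᶠ[𝓝 t] fun _ => 1 := by
      filter_upwards [lt_mem_nhds ht] with s hs using hχ1 s hs.le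
    rw [this.deriv_eq]
    simp
  -- `t χ'(t)` is bounded for `t ≥ 0`, by compactness of `[0, 2]` and because `χ'` vanishes beyond.
  -- This makes the derivative of `χ (n g)` harmless uniformly in `n`.
  obtain ⟨B, hB0, hB⟩ : ∃ B, 0 ≤ B ∧ ∀ t ≥ 0, |deriv χ t * t| ≤ B := by
    obtain ⟨B, hB⟩ := (isCompact_Icc (a := (0 : ℝ)) (b := 2)).exists_bound_of_continuousOn
      (f := fun t => deriv χ t * t) ((hχs.continuous_deriv (by simp)).mul continuous_id).continuousOn
    refine ⟨max B 0, le_max_right _ _, fun t ht => ?_⟩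
    rcases le_or_gt t 2 with h | h
    · exact le_max_of_le_left (hB t ⟨ht, h⟩)
    · simp [hχd t h]
  let F : ℕ → Space d → Space d := fun n =>
    D.indicator fun x => (χ (n * g x) * f x) • (r x • gradient f x)
  let K : ℕ → Set (Space d) := fun n => {x | x ∈ D ∧ 1 ≤ n * g x}
  have hgbc : ∀ y ∈ frontier D, Tendsto g (𝓝[D] y) (𝓝 0) := fun y hy => by
    have := (hbc y hy).inner (𝕜 := ℝ) (hbc y hy)
    simpa [hg] using this
  -- A limit point of `K n` on the boundary would satisfy `1 ≤ n * 0`, because `g` tends to `0`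
  -- there.
  have hK : ∀ n, IsCompact (K n) := fun n => by
    refine Metric.isCompact_of_isClosed_isBounded ?_ (hb.subset fun x hx => hx.1)
    refine isClosed_of_closure_subset fun y hy => ?_
    have hyD : y ∈ closure D := closure_mono (fun x hx => hx.1) hy
    have hlim : ∀ l, Tendsto g (𝓝[D] y) (𝓝 l) → 1 ≤ n * l := fun l hl => by
      have hne : (𝓝[K n] y).NeBot := mem_closure_iff_nhdsWithin_neBot.1 hy
      have h1 : Tendsto (fun x => (n : ℝ) * g x) (𝓝[K n] y) (𝓝 (n * l)) :=
        (hl.mono_left (nhdsWithin_mono y fun x hx => hx.1)).const_mul _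
      exact ge_of_tendsto h1 (by filter_upwards [self_mem_nhdsWithin] with x hx using hx.2)
    by_cases hy' : y ∈ D
    · exact ⟨hy', hlim _ (hgs.smooth.continuousOn y hy')⟩
    · have := hlim 0 (hgbc y ⟨hyD, fun h => hy' (interior_subset h)⟩)
      norm_num at this
  have hKD : ∀ n, K n ⊆ D := fun n x hx => hx.1
  have hF0 : ∀ n, ∀ x ∉ K n, F n x = 0 := fun n x hx => by
    by_cases hxD : x ∈ D
    · have : ¬ 1 ≤ n * g x := fun h => hx ⟨hxD, h⟩
      simp [F, Set.indicator_of_mem hxD, hχ0 _ (not_le.1 this)]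
    · simp [F, Set.indicator_of_notMem hxD]
  have hone : (1 : WithTop ℕ∞) ≤ ∞ := by exact_mod_cast le_top
  have hcut : ∀ n : ℕ, ContDiffOn ℝ 1 (fun x => χ (n * g x) * f x) D := fun n =>
    (hχs.comp_contDiffOn (contDiffOn_const.mul (hgs.smooth.of_le hone))).mul
      (hf.smooth.of_le hone)
  have hFeq : ∀ n, Set.EqOn (F n) (fun x => (χ (n * g x) * f x) • (r x • gradient f x)) D :=
    fun n x hx => Set.indicator_of_mem hx _
  have hF : ∀ n, ContDiff ℝ 1 (F n) := fun n =>
    contDiff_of_eq_zero_off_compact hD (hK n) (hKD n)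
      (((hcut n).smul (hV.smooth.of_le hone)).congr (hFeq n)) (hF0 n)
  -- The equation `∇·(r ∇f) = 0` leaves only the derivative of the factor `χ (n g) f` along `r ∇f`.
  have hFdiv : ∀ n, ∀ x ∈ D, divg (F n) x =
      r x * (f x * (n * deriv χ (n * g x)) * fderiv ℝ g x (gradient f x) + χ (n * g x) * g x) := by
    intro n x hx
    have hgd := hgs.differentiableAt hD hx
    have hfd := hf.differentiableAt hD hx
    have h1 : HasFDerivAt (fun x => χ (n * g x)) (deriv χ (n * g x) • ((n : ℝ) • fderiv ℝ g x)) x :=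
      ((hχs.differentiable (by simp) _).hasDerivAt).comp_hasFDerivAt x
        (hgd.hasFDerivAt.const_mul (n : ℝ))
    have h2 : HasFDerivAt (fun x => χ (n * g x) * f x) _ x := h1.mul hfd.hasFDerivAt
    rw [divg_congr_on hD (hFeq n) hx, divg_smul h2.differentiableAt (hV.differentiableAt hD hx),
      hdiv x hx, h2.fderiv]
    simp only [mul_zero, zero_add, add_apply, smul_apply, map_smul, smul_eq_mul]
    rw [show fderiv ℝ f x (gradient f x) = g x from (inner_gradient f x _).symm]
    ring
  obtain ⟨R, hR0, hR⟩ := hr.norm_le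
  obtain ⟨A, hA0, hA⟩ := hf.norm_le
  obtain ⟨G, hG0, hG'⟩ := hgs.norm_le
  obtain ⟨L, hL0, hL⟩ := (hG.fderiv hD).norm_le
  -- `∇g · ∇f` is twice the Hessian of `f` evaluated on `(∇f, ∇f)`, hence is controlled by `g`
  -- itself. The factor `n` from the cutoff thus always occurs as `n g χ'(n g)`, which is bounded by
  -- `B`.
  have hgd : ∀ x ∈ D, |fderiv ℝ g x (gradient f x)| ≤ 2 * L * g x := fun x hx => by
    have h1 := (hG.differentiableAt hD hx).hasFDerivAt
    have h2 := h1.inner ℝ h1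
    rw [h2.fderiv]
    have h3 : ‖fderiv ℝ (gradient f) x (gradient f x)‖ ≤ L * ‖gradient f x‖ :=
      (ContinuousLinearMap.le_opNorm _ _).trans
        (mul_le_mul_of_nonneg_right (hL x hx) (norm_nonneg _))
    have h4 : |inner ℝ (gradient f x) (fderiv ℝ (gradient f) x (gradient f x))| ≤ L * g x := by
      refine (abs_real_inner_le_norm _ _).trans ?_
      rw [hg]
      simp only [real_inner_self_eq_norm_sq]
      nlinarith [mul_le_mul_of_nonneg_left h3 (norm_nonneg (gradient f x))]
    have h5 : |inner ℝ (fderiv ℝ (gradient f) x (gradient f x)) (gradient f x)| ≤ L * g x := by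
      rwa [real_inner_comm]
    simp only [ContinuousLinearMap.comp_apply, fderivInnerCLM_apply,
      ContinuousLinearMap.prod_apply]
    refine (abs_add_le _ _).trans ?_
    linarith
  have hvol : volume D ≠ ⊤ := hb.measure_lt_top.ne
  have hint : ∀ n, ∫ x in D, divg (F n) x = 0 := fun n => by
    rw [setIntegral_eq_integral_of_forall_compl_eq_zero fun x hx =>
      divg_eq_zero_off_compact (hK n) (hF0 n) fun h => hx (hKD n h)]
    exact integral_divg_eq_zero (hK n) (hF n) (hF0 n)
  -- Dominated convergence: at each point the integrand is eventually equal to `r g`, either because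
  -- `∇f = 0` there or because `n g > 2`. As all the integrals vanish, so does the integral of `r g
  -- ≥ 0`.
  have hlim : Tendsto (fun n => ∫ x in D, divg (F n) x) atTop (𝓝 (∫ x in D, r x * g x)) := by
    refine tendsto_integral_of_dominated_convergence (fun _ => R * (A * B * (2 * L) + G))
      (fun n => (continuous_divg (hF n)).aestronglyMeasurable) ?_ ?_ ?_
    · exact integrableOn_const hvol
    · intro n
      refine (ae_restrict_iff' hD.measurableSet).2 (Eventually.of_forall fun x hx => ?_)
      rw [hFdiv n x hx, norm_mul]
      refine mul_le_mul (hR x hx) ?_ (norm_nonneg _) hR0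
      refine (norm_add_le _ _).trans (add_le_add ?_ ?_)
      · have h1 := hB (n * g x) (mul_nonneg (Nat.cast_nonneg n) (hg0 x))
        have h2 := hgd x hx
        have h3 : ‖f x‖ ≤ A := hA x hx
        rw [Real.norm_eq_abs] at h3 ⊢
        rw [abs_mul, abs_mul]
        calc |f x| * |n * deriv χ (n * g x)| * |fderiv ℝ g x (gradient f x)|
            ≤ |f x| * |n * deriv χ (n * g x)| * (2 * L * g x) :=
              mul_le_mul_of_nonneg_left h2 (by positivity)
          _ = |f x| * |deriv χ (n * g x) * (n * g x)| * (2 * L) := by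
              rw [abs_mul, abs_mul, abs_mul, abs_of_nonneg (hg0 x)]
              ring
          _ ≤ A * B * (2 * L) := by gcongr
      · rw [norm_mul]
        have h1 : ‖χ (n * g x)‖ ≤ 1 := by
          rw [Real.norm_of_nonneg (Real.smoothTransition.nonneg _)]
          exact Real.smoothTransition.le_one _
        calc _ ≤ 1 * G := mul_le_mul h1 (hG' x hx) (norm_nonneg _) zero_le_one
          _ = G := one_mul G
    · refine (ae_restrict_iff' hD.measurableSet).2 (Eventually.of_forall fun x hx => ?_)
      refine tendsto_const_nhds.congr' ?_
      rcases (hg0 x).eq_or_lt with h | h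
      · have h1 : gradient f x = 0 := inner_self_eq_zero.1 h.symm
        refine Eventually.of_forall fun n => ?_
        change r x * g x = divg (F n) x
        rw [hFdiv n x hx, h1, map_zero, ← h]
        ring
      · obtain ⟨n₀, hn₀⟩ := exists_nat_gt (2 / g x)
        filter_upwards [eventually_ge_atTop n₀] with n hn
        have h2 : 2 < n * g x := by
          rw [div_lt_iff₀ h] at hn₀
          have : (n₀ : ℝ) ≤ n := by exact_mod_cast hn
          nlinarith
        change r x * g x = divg (F n) x
        rw [hFdiv n x hx, hχd _ h2, hχ1 _ h2.le]
        ring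
  have hzero : ∫ x in D, r x * g x = 0 :=
    tendsto_nhds_unique hlim (by simpa only [hint] using tendsto_const_nhds)
  have hrg := hr.mul hD hgs
  obtain ⟨Q, _, hQ⟩ := hrg.norm_le
  have hrgi : IntegrableOn (fun x => r x * g x) D := by
    have : IsFiniteMeasure (volume.restrict D) := ⟨by simpa using hb.measure_lt_top⟩
    refine Integrable.of_bound (hrg.smooth.continuousOn.aestronglyMeasurable hD.measurableSet) Q ?_
    exact (ae_restrict_iff' hD.measurableSet).2 (Eventually.of_forall hQ)
  have hae := (setIntegral_eq_zero_iff_of_nonneg_ae ((ae_restrict_iff' hD.measurableSet).2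
    (Eventually.of_forall fun x hx => mul_nonneg (hr0 x hx).le (hg0 x))) hrgi).1 hzero
  have heq := Measure.eqOn_open_of_ae_eq hae hD hrg.smooth.continuousOn continuousOn_const
  intro x hx
  have h1 : r x * g x = 0 := heq hx
  exact inner_self_eq_zero.1 ((mul_eq_zero.1 h1).resolve_left (hr0 x hx).ne')

end Integral

/-! ### Explicit formulas for one step of the scheme -/

section Step

variable {d : ℕ} {D : Set (Space d)}

theorem tensorDivg_smul_single {f : Space d → ℝ} {x : Space d} (hf : DifferentiableAt ℝ f x) :
    tensorDivg (fun i y => f y • EuclideanSpace.single i (1 : ℝ)) x = gradient f x := by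
  ext i
  change divg (fun y => f y • EuclideanSpace.single i (1 : ℝ)) x = _
  have h0 : divg (fun _ : Space d => EuclideanSpace.single i (1 : ℝ)) x = 0 := by simp [divg]
  rw [divg_smul hf (differentiableAt_const _), h0, mul_zero, zero_add, ← inner_gradient,
    EuclideanSpace.inner_single_right]
  simp only [one_mul, conj_trivial]

theorem tensorDivg_congr_on (hD : IsOpen D) {S T : Fin d → Space d → Space d}
    (h : ∀ i, Set.EqOn (S i) (T i) D) {x : Space d} (hx : x ∈ D) :
    tensorDivg S x = tensorDivg T x := by
  ext i
  exact divg_congr_on hD (h i) hx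

theorem tensorDivg_add {S T : Fin d → Space d → Space d} {x : Space d}
    (hS : ∀ i, DifferentiableAt ℝ (S i) x) (hT : ∀ i, DifferentiableAt ℝ (T i) x) :
    tensorDivg (fun i y => S i y + T i y) x = tensorDivg S x + tensorDivg T x := by
  ext i
  exact divg_add (hS i) (hT i)

theorem tensorDivg_outer {m u : Space d → Space d} {x : Space d} (hm : DifferentiableAt ℝ m x)
    (hu : DifferentiableAt ℝ u x) :
    tensorDivg (fun i y => m y i • u y) x = advect u m x + divg u x • m x := by
  ext i
  change divg (fun y => m y i • u y) x = fderiv ℝ m x (u x) i + divg u x * m x i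
  have h1 : HasFDerivAt (fun y => m y i)
      ((EuclideanSpace.proj i : Space d →L[ℝ] ℝ) ∘L fderiv ℝ m x) x :=
    (EuclideanSpace.proj i : Space d →L[ℝ] ℝ).hasFDerivAt.comp x hm.hasFDerivAt
  rw [divg_smul h1.differentiableAt hu, h1.fderiv]
  change m x i * divg u x + fderiv ℝ m x (u x) i = _
  ring

theorem contDiffOn_gradient (hD : IsOpen D) {f : Space d → ℝ} (hf : ContDiffOn ℝ ∞ f D) :
    ContDiffOn ℝ ∞ (gradient f) D :=
  (rieszCLM d).contDiff.comp_contDiffOn (hf.fderiv_of_isOpen hD (by simp))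

/-- One step of the scheme from smooth data with positive density. -/
structure IsRegularStep (D : Set (Space d)) (γ a M dt : ℝ) (α β Φ : Space d → ℝ) (w : State d)
    (W₁ W₂ Wnew : RelaxState d) : Prop where
  isOpen : IsOpen D
  one_lt : 1 < γ
  mach_pos : 0 < M
  step : IsIMEXStep D γ a M dt α β w W₁ W₂ Wnew
  rho_pos : ∀ x ∈ D, 0 < w.rho x
  alpha_ne : ∀ x ∈ D, α x ≠ 0
  gradient_beta : ∀ x ∈ D, gradient β x = -(α x • gradient Φ x)
  smooth_rho : ContDiffOn ℝ ∞ w.rho D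
  smooth_velocity : ContDiffOn ℝ ∞ w.velocity D
  smooth_pressure : ContDiffOn ℝ ∞ (w.pressure γ M) D
  smooth_psi : ContDiffOn ℝ ∞ W₁.psi D
  smooth_potential : ContDiffOn ℝ ∞ Φ D

namespace IsRegularStep

variable {γ a M dt : ℝ} {α β Φ : Space d → ℝ} {w : State d} {W₁ W₂ Wnew : RelaxState d}

theorem _root_.ContDiffOn.top_differentiableAt {V : Type*} [NormedAddCommGroup V]
    [NormedSpace ℝ V] {f : Space d → V} (hf : ContDiffOn ℝ ∞ f D) (hD : IsOpen D) {x : Space d}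
    (hx : x ∈ D) : DifferentiableAt ℝ f x :=
  (hf.top_contDiffAt hD hx 1).differentiableAt (by simp)

theorem mom_eq (h : IsRegularStep D γ a M dt α β Φ w W₁ W₂ Wnew) {x : Space d} (hx : x ∈ D) :
    w.mom x = w.rho x • w.velocity x := by
  rw [State.velocity, smul_inv_smul₀ (h.rho_pos x hx).ne']

theorem energy_eq (h : IsRegularStep D γ a M dt α β Φ w W₁ W₂ Wnew) {x : Space d} (hx : x ∈ D) :
    w.energy x = (γ - 1)⁻¹ * w.pressure γ M x +
      1 / 2 * M ^ 2 * w.rho x * inner ℝ (w.velocity x) (w.velocity x) := by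
  have h1 := (h.rho_pos x hx).ne'
  have h2 : γ - 1 ≠ 0 := sub_ne_zero.2 h.one_lt.ne'
  rw [real_inner_self_eq_norm_sq, State.pressure, State.internalEnergy]
  field_simp
  ring

/-! ### The implicit stage: frozen variables and the elliptic equation -/

section ImplicitStage

theorem implicit_rho (h : IsRegularStep D γ a M dt α β Φ w W₁ W₂ Wnew) {x : Space d}
    (hx : x ∈ D) : W₁.rho x = w.rho x := by
  have := congrArg (fun v => v.1) (h.step.implicit_step x hx)
  simp only [RelaxState.val, RelaxFlux.div, fluxG, sourceI, State.equilibrium, Prod.fst_add,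
    Prod.fst_sub, Prod.smul_fst, Pi.zero_apply, smul_zero] at this
  rw [show (0 : Space d → Space d) = fun _ => 0 from rfl, divg_zero] at this
  simpa [sub_eq_zero] using this

theorem implicit_mom (h : IsRegularStep D γ a M dt α β Φ w W₁ W₂ Wnew) {x : Space d}
    (hx : x ∈ D) : W₁.mom x = w.mom x := by
  have := congrArg (fun v => v.2.1) (h.step.implicit_step x hx)
  simp only [RelaxState.val, RelaxFlux.div, fluxG, sourceI, State.equilibrium, Prod.fst_add,
    Prod.fst_sub, Prod.smul_fst, Prod.snd_add, Prod.snd_sub, Prod.smul_snd, Pi.zero_apply,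
    smul_zero] at this
  rw [show tensorDivg (0 : Fin d → Space d → Space d) x = 0 from by
    ext i; exact divg_zero x] at this
  simpa [sub_eq_zero] using this

theorem implicit_energy (h : IsRegularStep D γ a M dt α β Φ w W₁ W₂ Wnew) {x : Space d}
    (hx : x ∈ D) : W₁.energy x = w.energy x := by
  have := congrArg (fun v => v.2.2.1) (h.step.implicit_step x hx)
  simp only [RelaxState.val, RelaxFlux.div, fluxG, sourceI, State.equilibrium, Prod.fst_add,
    Prod.fst_sub, Prod.smul_fst, Prod.snd_add, Prod.snd_sub, Prod.smul_snd, Pi.zero_apply,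
    smul_zero] at this
  rw [show (0 : Space d → Space d) = fun _ => 0 from rfl, divg_zero] at this
  simpa [sub_eq_zero] using this

theorem implicit_slowPressure (h : IsRegularStep D γ a M dt α β Φ w W₁ W₂ Wnew) {x : Space d}
    (hx : x ∈ D) : W₁.slowPressure x = w.pressure γ M x := by
  have := congrArg (fun v => v.2.2.2.1) (h.step.implicit_step x hx)
  simp only [RelaxState.val, RelaxFlux.div, fluxG, sourceI, State.equilibrium, Prod.fst_add,
    Prod.fst_sub, Prod.smul_fst, Prod.snd_add, Prod.snd_sub, Prod.smul_snd, Pi.zero_apply,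
    smul_zero] at this
  rw [show (0 : Space d → Space d) = fun _ => 0 from rfl, divg_zero, smul_zero, add_zero,
    sub_eq_zero] at this
  rw [RelaxState.slowPressure, this, h.implicit_rho hx, mul_div_cancel_left₀ _ (h.rho_pos x hx).ne']

theorem implicit_zed (h : IsRegularStep D γ a M dt α β Φ w W₁ W₂ Wnew) {x : Space d}
    (hx : x ∈ D) : W₁.zed x = β x := by
  have := congrArg (fun v => v.2.2.2.2.2.2) (h.step.implicit_step x hx)
  simp only [RelaxState.val, RelaxFlux.div, fluxG, sourceI, State.equilibrium, Prod.snd_add, Prod.snd_sub, Prod.smul_snd, Pi.zero_apply,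
    smul_zero] at this
  rw [show (0 : Space d → Space d) = fun _ => 0 from rfl, divg_zero, smul_zero, add_zero,
    sub_eq_zero] at this
  rw [RelaxState.zed, this, h.implicit_rho hx, mul_div_cancel_left₀ _ (h.rho_pos x hx).ne']

theorem implicit_velocity (h : IsRegularStep D γ a M dt α β Φ w W₁ W₂ Wnew) {x : Space d}
    (hx : x ∈ D) : W₁.velocity x = w.velocity x := by
  rw [RelaxState.velocity, h.implicit_rho hx, h.implicit_mom hx, State.velocity]

/-- `Z` is frozen at `β`, and `∇β = -α ∇Φ`, so `α` cancels and the source is plain gravity.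
Elsewhere `α` and `β` act only through `Φ`. -/
theorem source_eq (h : IsRegularStep D γ a M dt α β Φ w W₁ W₂ Wnew) {x : Space d}
    (hx : x ∈ D) : (W₁.rho x / α x) • gradient W₁.zed x = -(w.rho x • gradient Φ x) := by
  rw [gradient_congr_on h.isOpen (fun y hy => h.implicit_zed hy) hx, h.gradient_beta x hx,
    h.implicit_rho hx, smul_neg, smul_smul, div_mul_cancel₀ _ (h.alpha_ne x hx)]

theorem implicit_uhat (h : IsRegularStep D γ a M dt α β Φ w W₁ W₂ Wnew) {x : Space d}
    (hx : x ∈ D) : W₁.uhat x = w.velocity x -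
      (dt / M ^ 2) • ((w.rho x)⁻¹ • (gradient W₁.psi x + w.rho x • gradient Φ x)) := by
  have := congrArg (fun v => v.2.2.2.2.1) (h.step.implicit_step x hx)
  simp only [RelaxState.val, RelaxFlux.div, fluxG, sourceI, State.equilibrium, Prod.fst_add,
    Prod.fst_sub, Prod.smul_fst, Prod.snd_add, Prod.snd_sub, Prod.smul_snd] at this
  rw [tensorDivg_smul_single (h.smooth_psi.top_differentiableAt h.isOpen hx), h.source_eq hx]
    at this
  have h2 : W₁.rhoUhat x = w.mom x - (dt / M ^ 2) • (gradient W₁.psi x + w.rho x • gradient Φ x) := by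
    rw [smul_neg] at this
    rw [smul_add, ← sub_eq_zero]
    rw [← sub_eq_zero] at this
    rw [← this]
    abel
  rw [RelaxState.uhat, h2, h.implicit_rho hx, smul_sub, State.velocity, smul_comm]

theorem differentiableAt_flux (h : IsRegularStep D γ a M dt α β Φ w W₁ W₂ Wnew) {x : Space d}
    (hx : x ∈ D) : DifferentiableAt ℝ
      (fun y => (w.rho y)⁻¹ • (gradient W₁.psi y + w.rho y • gradient Φ y)) x := by
  have h1 := h.smooth_rho.top_differentiableAt h.isOpen hx
  have h2 := (contDiffOn_gradient h.isOpen h.smooth_psi).top_differentiableAt h.isOpen hx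
  have h3 := (contDiffOn_gradient h.isOpen h.smooth_potential).top_differentiableAt h.isOpen hx
  exact (h1.inv (h.rho_pos x hx).ne').smul (h2.add (h1.smul h3))

/-- The elliptic equation for the implicit pressure. -/
theorem elliptic (h : IsRegularStep D γ a M dt α β Φ w W₁ W₂ Wnew) {x : Space d} (hx : x ∈ D) :
    dt ^ 2 * a ^ 2 *
        divg (fun y => (w.rho y)⁻¹ • (gradient W₁.psi y + w.rho y • gradient Φ y)) x
      = M ^ 2 * (w.rho x * (W₁.psi x - w.pressure γ M x) + dt * a ^ 2 * divg w.velocity x) := by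
  have := congrArg (fun v => v.2.2.2.2.2.1) (h.step.implicit_step x hx)
  simp only [RelaxState.val, RelaxFlux.div, fluxG, sourceI, State.equilibrium, Prod.fst_add,
    Prod.fst_sub, Prod.smul_fst, Prod.snd_add, Prod.snd_sub, Prod.smul_snd, Pi.zero_apply,
    smul_zero] at this
  have hu := h.smooth_velocity.top_differentiableAt h.isOpen hx
  have hX := h.differentiableAt_flux hx
  have hX' : DifferentiableAt ℝ (fun y => (dt / M ^ 2) •
      ((w.rho y)⁻¹ • (gradient W₁.psi y + w.rho y • gradient Φ y))) x := hX.fun_const_smul _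
  have hd : DifferentiableAt ℝ (fun y => w.velocity y - (dt / M ^ 2) •
      ((w.rho y)⁻¹ • (gradient W₁.psi y + w.rho y • gradient Φ y))) x := hu.sub hX'
  have h1 : W₁.rhoPsi x = w.rho x * W₁.psi x := by
    rw [RelaxState.psi, h.implicit_rho hx, mul_div_cancel₀ _ (h.rho_pos x hx).ne']
  -- Elimination of `û`. The factor `a² M²` of the flux compensates the prefactor `dt / M²`, so the
  -- `ψ` equation reads `ρ (ψ - p) + dt a² ∇·(u - (dt / M²) X) = 0`.
  rw [divg_congr_on h.isOpen (fun y hy => by simp only [h.implicit_uhat hy]; rfl) hx,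
    divg_const_smul hd, divg_sub hu hX',
    divg_const_smul hX, h1, smul_eq_mul] at this
  have hM := h.mach_pos.ne'
  generalize divg (fun y => (w.rho y)⁻¹ • (gradient W₁.psi y + w.rho y • gradient Φ y)) x = q
    at this ⊢
  field_simp at this
  linear_combination -this

end ImplicitStage

/-! ### The explicit stage: density, momentum and energy at the new time -/

section ExplicitStage

theorem new_eq (h : IsRegularStep D γ a M dt α β Φ w W₁ W₂ Wnew) {x : Space d} (hx : x ∈ D) :
    Wnew.rho x = W₂.rho x ∧ Wnew.mom x = W₂.mom x ∧ Wnew.energy x = W₂.energy x := by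
  have := h.step.projection x hx
  simp only [RelaxState.val, State.equilibrium, RelaxState.phys, Prod.mk.injEq] at this
  exact ⟨this.1, this.2.1, this.2.2.1⟩

theorem new_rho (h : IsRegularStep D γ a M dt α β Φ w W₁ W₂ Wnew) {x : Space d} (hx : x ∈ D) :
    Wnew.rho x = w.rho x - dt * divg (fun y => w.rho y • w.velocity y) x := by
  have := congrArg (fun v => v.1) (h.step.explicit_step x hx)
  simp only [RelaxState.val, RelaxFlux.div, fluxF, sourceE, Prod.fst_add,
    Prod.fst_sub, Prod.smul_fst, Pi.zero_apply, smul_zero] at this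
  rw [divg_congr_on h.isOpen (fun y hy => (h.implicit_mom hy).trans (h.mom_eq hy)) hx,
    h.implicit_rho hx, smul_eq_mul] at this
  rw [(h.new_eq hx).1]
  linarith

/-- Writing `(1 - M²) / M² = M⁻² - 1` collects all singular terms in `M⁻² (∇ψ + ρ ∇Φ)`, the
combination that the elliptic equation controls; what is left over is `∇p - ∇ψ`. -/
theorem new_mom (h : IsRegularStep D γ a M dt α β Φ w W₁ W₂ Wnew) {x : Space d} (hx : x ∈ D) :
    Wnew.mom x = w.rho x • w.velocity x
      - dt • (advect w.velocity (fun y => w.rho y • w.velocity y) x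
        + divg w.velocity x • (w.rho x • w.velocity x)
        + (gradient (w.pressure γ M) x - gradient W₁.psi x))
      - dt • ((M ^ 2)⁻¹ • (gradient W₁.psi x + w.rho x • gradient Φ x)) := by
  have := congrArg (fun v => v.2.1) (h.step.explicit_step x hx)
  simp only [RelaxState.val, RelaxFlux.div, fluxF, sourceE, Prod.fst_add,
    Prod.fst_sub, Prod.smul_fst, Prod.snd_add, Prod.snd_sub, Prod.smul_snd] at this
  have hr := h.smooth_rho.top_differentiableAt h.isOpen hx
  have hu := h.smooth_velocity.top_differentiableAt h.isOpen hx
  have hp := h.smooth_pressure.top_differentiableAt h.isOpen hx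
  have hψ := h.smooth_psi.top_differentiableAt h.isOpen hx
  have hm : DifferentiableAt ℝ (fun y => w.rho y • w.velocity y) x := hr.smul hu
  have hψ' : DifferentiableAt ℝ (fun y => (1 - M ^ 2) / M ^ 2 * W₁.psi y) x := hψ.const_mul _
  have hP : DifferentiableAt ℝ
      (fun y => w.pressure γ M y + (1 - M ^ 2) / M ^ 2 * W₁.psi y) x := hp.add hψ'
  have hmi : ∀ i : Fin d, DifferentiableAt ℝ (fun y => (w.rho y • w.velocity y) i) x := fun i =>
    ((EuclideanSpace.proj i : Space d →L[ℝ] ℝ).hasFDerivAt.comp x hm.hasFDerivAt).differentiableAt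
  have hS : ∀ i : Fin d, DifferentiableAt ℝ
      (fun y => (w.rho y • w.velocity y) i • w.velocity y) x := fun i => (hmi i).smul hu
  have hT : ∀ i : Fin d, DifferentiableAt ℝ (fun y =>
      (w.pressure γ M y + (1 - M ^ 2) / M ^ 2 * W₁.psi y) • EuclideanSpace.single i (1 : ℝ)) x :=
    fun i => hP.fun_smul (differentiableAt_const _)
  have hflux : ∀ i : Fin d, Set.EqOn
      (fun y => W₁.mom y i • W₁.velocity y +
        (W₁.slowPressure y + (1 - M ^ 2) / M ^ 2 * W₁.psi y) • EuclideanSpace.single i (1 : ℝ))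
      (fun y => (w.rho y • w.velocity y) i • w.velocity y +
        (w.pressure γ M y + (1 - M ^ 2) / M ^ 2 * W₁.psi y) • EuclideanSpace.single i (1 : ℝ)) D :=
    fun i y hy => by
      simp only [h.implicit_velocity hy, h.implicit_mom hy, h.mom_eq hy, h.implicit_slowPressure hy]
  rw [tensorDivg_congr_on h.isOpen hflux hx,
    tensorDivg_add hS hT,
    tensorDivg_outer hm hu, tensorDivg_smul_single hP, gradient_add hp hψ', gradient_const_mul hψ,
    mul_smul, h.source_eq hx, h.implicit_mom hx, h.mom_eq hx] at this
  rw [(h.new_eq hx).2.1]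
  have h2 := eq_add_of_sub_eq (eq_sub_of_add_eq this)
  rw [h2]
  have hM := h.mach_pos.ne'
  have h3 : (1 - M ^ 2) / M ^ 2 = (M ^ 2)⁻¹ - 1 := by field_simp
  rw [h3, one_div]
  module

theorem new_energy (h : IsRegularStep D γ a M dt α β Φ w W₁ W₂ Wnew) {x : Space d} (hx : x ∈ D) :
    Wnew.energy x = w.energy x
      - dt * divg (fun y =>
          (w.energy y + M ^ 2 * w.pressure γ M y + (1 - M ^ 2) * W₁.psi y) • w.velocity y) x
      - dt * (w.rho x * inner ℝ (w.velocity x) (gradient Φ x)) := by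
  have := congrArg (fun v => v.2.2.1) (h.step.explicit_step x hx)
  simp only [RelaxState.val, RelaxFlux.div, fluxF, sourceE, Prod.fst_add,
    Prod.fst_sub, Prod.smul_fst, Prod.snd_add, Prod.snd_sub, Prod.smul_snd] at this
  rw [← real_inner_smul_right, h.source_eq hx, inner_neg_right, real_inner_smul_right,
    h.implicit_velocity hx, h.implicit_energy hx, smul_eq_mul, smul_eq_mul] at this
  rw [divg_congr_on h.isOpen (fun y hy => by
    simp only [h.implicit_velocity hy, h.implicit_energy hy, h.implicit_slowPressure hy]; rfl) hx]
    at this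
  rw [(h.new_eq hx).2.2]
  linarith

end ExplicitStage

end IsRegularStep

end Step

/-! ### The implicit pressure in the low Mach number limit -/

section ImplicitPressure

variable {d : ℕ} {D : Set (Space d)}

theorem sum_antidiagonal_one {V : Type*} [AddCommMonoid V] (f : ℕ × ℕ → V) :
    ∑ ij ∈ Finset.HasAntidiagonal.antidiagonal 1, f ij = f (0, 1) + f (1, 0) := by
  simp [Finset.Nat.antidiagonal_succ]

theorem sum_antidiagonal_two {V : Type*} [AddCommMonoid V] (f : ℕ × ℕ → V) :
    ∑ ij ∈ Finset.HasAntidiagonal.antidiagonal 2, f ij = f (0, 2) + (f (1, 1) + f (2, 0)) := by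
  simp [Finset.Nat.antidiagonal_succ]

namespace HasMachExpansion

theorem gradient (hD : IsOpen D) {N : ℕ} {f : ℝ → Space d → ℝ} {c : ℕ → Space d → ℝ}
    (hf : HasMachExpansion D N f c) :
    HasMachExpansion D N (fun M => gradient (f M)) (fun k => gradient (c k)) :=
  (hf.fderiv hD).clm hD (rieszCLM d)

theorem divg (hD : IsOpen D) {N : ℕ} {f : ℝ → Space d → Space d} {c : ℕ → Space d → Space d}
    (hf : HasMachExpansion D N f c) :
    HasMachExpansion D N (fun M => divg (f M)) (fun k => divg (c k)) :=
  (((hf.fderiv hD).clm hD (traceCLM d)).congr hD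
    (Eventually.of_forall fun M x _ => (divg_eq (f M) x).symm)).congr_coeff hD
    fun k _ x _ => (divg_eq (c k) x).symm

theorem smul (hD : IsOpen D) {V : Type*} [NormedAddCommGroup V] [NormedSpace ℝ V] {N : ℕ}
    {f : ℝ → Space d → ℝ} {g : ℝ → Space d → V} {c : ℕ → Space d → ℝ} {e : ℕ → Space d → V}
    (hf : HasMachExpansion D N f c) (hg : HasMachExpansion D N g e) :
    HasMachExpansion D N (fun M x => f M x • g M x)
      (fun k x => ∑ ij ∈ Finset.HasAntidiagonal.antidiagonal k, c ij.1 x • e ij.2 x) :=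
  hf.bilin hD (ContinuousLinearMap.lsmul ℝ ℝ) hg

theorem inner (hD : IsOpen D) {N : ℕ} {f g : ℝ → Space d → Space d}
    {c e : ℕ → Space d → Space d} (hf : HasMachExpansion D N f c)
    (hg : HasMachExpansion D N g e) :
    HasMachExpansion D N (fun M x => inner ℝ (f M x) (g M x))
      (fun k x => ∑ ij ∈ Finset.HasAntidiagonal.antidiagonal k, inner ℝ (c ij.1 x) (e ij.2 x)) :=
  hf.bilin hD (innerSL ℝ) hg

theorem advect (hD : IsOpen D) {N : ℕ} {f g : ℝ → Space d → Space d}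
    {c e : ℕ → Space d → Space d} (hf : HasMachExpansion D N f c)
    (hg : HasMachExpansion D N g e) :
    HasMachExpansion D N (fun M => advect (f M) (g M))
      (fun k x => ∑ ij ∈ Finset.HasAntidiagonal.antidiagonal k,
        _root_.fderiv ℝ (e ij.1) x (c ij.2 x)) :=
  (hg.fderiv hD).bilin hD (ContinuousLinearMap.id ℝ _) hf

/-- A bilinear expression in a family and a field independent of the Mach number. -/
theorem bilin_const (hD : IsOpen D) {U V W : Type*} [NormedAddCommGroup U] [NormedSpace ℝ U]
    [NormedAddCommGroup V] [NormedSpace ℝ V] [NormedAddCommGroup W] [NormedSpace ℝ W]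
    (B : U →L[ℝ] V →L[ℝ] W) {N : ℕ} {f : ℝ → Space d → U} {c : ℕ → Space d → U}
    (hf : HasMachExpansion D N f c) {g : Space d → V} (hg : SmoothBdd D g) :
    HasMachExpansion D N (fun M x => B (f M x) (g x)) (fun k x => B (c k x) (g x)) :=
  of_uniformOrder hD (fun k hk => (hf.coeff k hk).bilin hD B hg)
    (((hf.uniformOrder_sub hD).bilin hD B hg.uniformOrder).congr hD
      (Eventually.of_forall fun M x _ => by simp [machSum, _root_.sum_apply]))

theorem inner_const (hD : IsOpen D) {N : ℕ} {f : ℝ → Space d → Space d}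
    {c : ℕ → Space d → Space d} (hf : HasMachExpansion D N f c) {g : Space d → Space d}
    (hg : SmoothBdd D g) :
    HasMachExpansion D N (fun M x => Inner.inner ℝ (f M x) (g x))
      (fun k x => Inner.inner ℝ (c k x) (g x)) :=
  hf.bilin_const hD (innerSL ℝ) hg

theorem smul_const (hD : IsOpen D) {N : ℕ} {f : ℝ → Space d → ℝ} {c : ℕ → Space d → ℝ}
    (hf : HasMachExpansion D N f c) {g : Space d → Space d} (hg : SmoothBdd D g) :
    HasMachExpansion D N (fun M x => f M x • g x) (fun k x => c k x • g x) :=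
  hf.bilin_const hD (ContinuousLinearMap.lsmul ℝ ℝ) hg

/-- A family with positive leading coefficient is positive for small Mach numbers. -/
theorem eventually_lt (hD : IsOpen D) {N : ℕ} {f : ℝ → Space d → ℝ} {c : ℕ → Space d → ℝ}
    (hf : HasMachExpansion D N f c) {m : ℝ} (hm : 0 < m) (hc : ∀ x ∈ D, m ≤ c 0 x) :
    ∀ᶠ M : ℝ in 𝓝[>] 0, ∀ x ∈ D, m / 2 < f M x := by
  obtain ⟨C, _, hC⟩ := ((hf.truncate hD (Nat.zero_le N)).uniformOrder_sub hD).norm_le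
  have h1 : Tendsto (fun M : ℝ => C * M ^ (0 + 1)) (𝓝[>] 0) (𝓝 0) := by
    have : Tendsto (fun M : ℝ => C * M ^ (0 + 1)) (𝓝 0) (𝓝 (C * 0 ^ (0 + 1))) :=
      Continuous.tendsto (by fun_prop) _
    simpa using this.mono_left nhdsWithin_le_nhds
  filter_upwards [hC, h1.eventually_lt_const (half_pos hm)] with M h2 h3 x hx
  have h4 := h2 x hx
  simp only [machSum, zero_add, Finset.sum_range_one, pow_zero, one_smul, Real.norm_eq_abs] at h4
  have h5 := hc x hx
  have h6 := (abs_le.1 h4).1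
  simp only [zero_add] at h3
  linarith

end HasMachExpansion

/-- Families `rho`, `vel`, `pres` with expansions whose coefficients are well-prepared for the
potential `Φ`, the density being bounded below by `m`. -/
structure IsPrepared (D : Set (Space d)) (m : ℝ) (Φ : Space d → ℝ) (N : ℕ)
    (rho : ℝ → Space d → ℝ) (vel : ℝ → Space d → Space d) (pres : ℝ → Space d → ℝ)
    (ρ : ℕ → Space d → ℝ) (u : ℕ → Space d → Space d) (p : ℕ → Space d → ℝ) : Prop where
  isOpen : IsOpen D
  pos : 0 < m
  potential : SmoothBdd D Φ
  density : HasMachExpansion D N rho ρ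
  velocity : HasMachExpansion D N vel u
  pressure : HasMachExpansion D N pres p
  le_density : ∀ x ∈ D, m ≤ ρ 0 x
  gradient_zero : ∀ x ∈ D, gradient (p 0) x = -(ρ 0 x • gradient Φ x)
  gradient_one : ∀ x ∈ D, gradient (p 1) x = -(ρ 1 x • gradient Φ x)
  div_momentum : ∀ x ∈ D, divg (fun y => ρ 0 y • u 0 y) x = 0
  div_velocity : ∀ x ∈ D, divg (u 0) x = 0
  orthogonal : ∀ x ∈ D, inner ℝ (u 0 x) (gradient Φ x) = 0

variable {m : ℝ} {Φ : Space d → ℝ} {K : ℕ}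
    {rho : ℝ → Space d → ℝ} {vel : ℝ → Space d → Space d} {pres : ℝ → Space d → ℝ}
    {ρ : ℕ → Space d → ℝ} {u : ℕ → Space d → Space d} {p : ℕ → Space d → ℝ}

/-- If `∇f = ρ₀ X` and `∇ · X = 0`, and `∇f` vanishes on the boundary, then `∇f = 0`. -/
theorem gradient_eq_zero_of_eq_smul (hD : IsOpen D) (hb : Bornology.IsBounded D) (hm : 0 < m)
    {f r : Space d → ℝ} {X : Space d → Space d} (hf : SmoothBdd D f) (hr : SmoothBdd D r)
    (hmr : ∀ x ∈ D, m ≤ r x) (hX : ∀ x ∈ D, gradient f x = r x • X x)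
    (hdiv : ∀ x ∈ D, divg X x = 0)
    (hbc : ∀ y ∈ frontier D, Tendsto (gradient f) (𝓝[D] y) (𝓝 0)) :
    ∀ x ∈ D, gradient f x = 0 := by
  have hpos : ∀ x ∈ D, 0 < r x := fun x hx => hm.trans_le (hmr x hx)
  refine gradient_eq_zero_of_divg_eq_zero hD hb hf (hr.inv hD hm hmr)
    (fun x hx => inv_pos.2 (hpos x hx)) (fun x hx => ?_) hbc
  rw [divg_congr_on hD (fun y hy => by
    simp only [hX y hy]; exact inv_smul_smul₀ (hpos y hy).ne' _) hx]
  exact hdiv x hx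

/-- The right side of the elliptic equation carries `M²`, so the first two coefficients of `X` are
divergence free, and hydrostatic balance makes each a gradient divided by `ρ₀`. The energy argument
removes them one after the other. -/
theorem IsPrepared.implicit_pressure (hw : IsPrepared D m Φ (K + 2) rho vel pres ρ u p)
    (hc : IsConnected D) (hb : Bornology.IsBounded D) {a dt : ℝ} (ha : 0 < a) (hdt : 0 < dt)
    {psi : ℝ → Space d → ℝ} {ψ : ℕ → Space d → ℝ} (hψ : HasMachExpansion D (K + 2) psi ψ)
    (hell : ∀ᶠ M : ℝ in 𝓝[>] 0, ∀ x ∈ D, dt ^ 2 * a ^ 2 *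
        divg (fun y => (rho M y)⁻¹ • (gradient (psi M) y + rho M y • gradient Φ y)) x
      = M ^ 2 * (rho M x * (psi M x - pres M x) + dt * a ^ 2 * divg (vel M) x))
    (hbc : ∀ k ≤ 1, ∀ y ∈ frontier D,
      Tendsto (fun x => gradient (ψ k) x - gradient (p k) x) (𝓝[D] y) (𝓝 0)) :
    ∃ (κ : ℝ) (X : Space d → Space d), SmoothBdd D X ∧
      (∀ x ∈ D, ψ 0 x = p 0 x + κ) ∧
      (∀ x ∈ D, gradient (ψ 0) x = gradient (p 0) x) ∧
      (∀ x ∈ D, gradient (ψ 1) x = gradient (p 1) x) ∧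
      (∀ x ∈ D, ρ 0 x • X x = gradient (ψ 2) x + ρ 2 x • gradient Φ x) ∧
      (∀ x ∈ D, divg X x = κ / (dt ^ 2 * a ^ 2) * ρ 0 x) := by
  have hD := hw.isOpen
  have hG := hw.potential.gradient hD
  have hY := (hψ.gradient hD).add hD (hw.density.smul_const hD hG)
  have hpos := hw.density.eventually_lt hD hw.pos hw.le_density
  obtain ⟨X, hX⟩ := hY.exists_inv_smul hD hw.density (half_pos hw.pos) hpos
    fun x hx => (half_le_self hw.pos.le).trans (hw.le_density x hx)
  have hprod := (hw.density.smul hD hX).congr hD (g := fun M x =>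
      gradient (psi M) x + rho M x • gradient Φ x) <| by
    filter_upwards [hpos] with M hM x hx
    exact smul_inv_smul₀ ((half_pos hw.pos).trans (hM x hx)).ne' _
  have hYX := hprod.unique hD hY
  -- `hB` expands the bracket on the right side of the elliptic equation; multiplication by `M²`
  -- shifts it by two, so its leading coefficient first appears at order two.
  have hB := (hw.density.smul hD (hψ.sub hD hw.pressure)).add hD
    ((hw.velocity.divg hD).const_smul hD (dt * a ^ 2))
  have hdivX := (((hX.divg hD).const_smul hD (dt ^ 2 * a ^ 2)).congr hD
    (g := fun M x => M ^ 2 • (rho M x • (psi M x - pres M x) + (dt * a ^ 2) • divg (vel M) x)) <| by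
      filter_upwards [hell] with M hM x hx
      exact hM x hx).unique hD ((hB.shift hD 2).truncate hD (by omega))
  have hne : dt ^ 2 * a ^ 2 ≠ 0 := by positivity
  have hd0 : ∀ x ∈ D, divg (X 0) x = 0 := fun x hx => by
    have := hdivX 0 (by omega) x hx
    simpa [hne] using this
  have hd1 : ∀ x ∈ D, divg (X 1) x = 0 := fun x hx => by
    have := hdivX 1 (by omega) x hx
    simpa [hne] using this
  -- The term `dt a² ∇·u₀` drops out because `u₀` is divergence free.
  have hd2 : ∀ x ∈ D, dt ^ 2 * a ^ 2 * divg (X 2) x = ρ 0 x * (ψ 0 x - p 0 x) := fun x hx => by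
    have := hdivX 2 (by omega) x hx
    simpa [hw.div_velocity x hx] using this
  have hψc : ∀ k ≤ 2, SmoothBdd D (ψ k) := fun k hk => hψ.coeff k (by omega)
  have hpc : ∀ k ≤ 2, SmoothBdd D (p k) := fun k hk => hw.pressure.coeff k (by omega)
  have hgsub : ∀ k ≤ 2, ∀ x ∈ D, gradient (fun y => ψ k y - p k y) x =
      gradient (ψ k) x - gradient (p k) x := fun k hk x hx =>
    gradient_sub ((hψc k hk).differentiableAt hD hx) ((hpc k hk).differentiableAt hD hx)
  have hbc' : ∀ k ≤ 1, ∀ y ∈ frontier D,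
      Tendsto (gradient fun y => ψ k y - p k y) (𝓝[D] y) (𝓝 0) := fun k hk y hy =>
    (hbc k hk y hy).congr' (by
      filter_upwards [self_mem_nhdsWithin] with x hx using (hgsub k (by omega) x hx).symm)
  have hr0 : SmoothBdd D (ρ 0) := hw.density.coeff 0 (by omega)
  have hρne : ∀ x ∈ D, ρ 0 x ≠ 0 := fun x hx => (hw.pos.trans_le (hw.le_density x hx)).ne'
  have hf0 : ∀ x ∈ D, gradient (fun y => ψ 0 y - p 0 y) x = ρ 0 x • X 0 x := fun x hx => by
    have := hYX 0 (by omega) x hx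
    simp only [Finset.HasAntidiagonal.antidiagonal_zero, Finset.sum_singleton] at this
    rw [this, hgsub 0 (by omega) x hx, hw.gradient_zero x hx, sub_neg_eq_add]
  have hg0 := gradient_eq_zero_of_eq_smul hD hb hw.pos ((hψc 0 (by omega)).sub hD (hpc 0 (by omega)))
    hr0 hw.le_density hf0 hd0 (hbc' 0 (by omega))
  have hX0 : ∀ x ∈ D, X 0 x = 0 := fun x hx => by
    have := hf0 x hx
    rw [hg0 x hx] at this
    exact (smul_eq_zero.1 this.symm).resolve_left (hρne x hx)
  -- The first order coefficient of `ρ X` is `ρ₀ X₁ + ρ₁ X₀`. Only after `X₀ = 0` does it have the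
  -- form needed for the energy argument.
  have hf1 : ∀ x ∈ D, gradient (fun y => ψ 1 y - p 1 y) x = ρ 0 x • X 1 x := fun x hx => by
    have := hYX 1 (by omega) x hx
    rw [sum_antidiagonal_one, hX0 x hx, smul_zero, add_zero] at this
    rw [this, hgsub 1 (by omega) x hx, hw.gradient_one x hx, sub_neg_eq_add]
  have hg1 := gradient_eq_zero_of_eq_smul hD hb hw.pos ((hψc 1 (by omega)).sub hD (hpc 1 (by omega)))
    hr0 hw.le_density hf1 hd1 (hbc' 1 (by omega))
  have hX1 : ∀ x ∈ D, X 1 x = 0 := fun x hx => by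
    have := hf1 x hx
    rw [hg1 x hx] at this
    exact (smul_eq_zero.1 this.symm).resolve_left (hρne x hx)
  -- Connectedness is used here. Nothing normalises the constant, since the boundary conditions
  -- involve gradients only.
  obtain ⟨κ, hκ⟩ := hD.exists_is_const_of_fderiv_eq_zero hc.isPreconnected
    (f := fun y => ψ 0 y - p 0 y) (𝕜 := ℝ)
    (fun x hx => (((hψc 0 (by omega)).sub hD
      (hpc 0 (by omega))).differentiableAt hD hx).differentiableWithinAt) (fun x hx => by
      ext v
      rw [← inner_gradient, hg0 x hx, inner_zero_left]
      rfl)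
  refine ⟨κ, X 2, hX.coeff 2 (by omega), fun x hx => ?_, fun x hx => ?_, fun x hx => ?_,
    fun x hx => ?_, fun x hx => ?_⟩
  · linarith [hκ x hx]
  · exact sub_eq_zero.1 ((hgsub 0 (by omega) x hx).symm.trans (hg0 x hx))
  · exact sub_eq_zero.1 ((hgsub 1 (by omega) x hx).symm.trans (hg1 x hx))
  · have := hYX 2 (by omega) x hx
    rw [sum_antidiagonal_two, hX0 x hx, hX1 x hx, smul_zero, smul_zero, add_zero, add_zero] at this
    exact this
  · have := hd2 x hx
    rw [hκ x hx] at this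
    field_simp
    linarith

end ImplicitPressure

/-! ### Expansions at the new time level -/

section NewTime

variable {d : ℕ} {D : Set (Space d)} {m : ℝ} {Φ : Space d → ℝ} {K : ℕ}
    {rho : ℝ → Space d → ℝ} {vel : ℝ → Space d → Space d} {pres : ℝ → Space d → ℝ}
    {ρ : ℕ → Space d → ℝ} {u : ℕ → Space d → Space d} {p : ℕ → Space d → ℝ}

/-- The rate of change of the first order density. -/
def densityRate (ρ : ℕ → Space d → ℝ) (u : ℕ → Space d → Space d) (x : Space d) : ℝ :=
  divg (fun y => ρ 0 y • u 1 y + ρ 1 y • u 0 y) x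

/-- The part of the rate of change of the first order pressure that is determined by the data. -/
def pressureRate (γ : ℝ) (Φ : Space d → ℝ) (ρ : ℕ → Space d → ℝ) (u : ℕ → Space d → Space d)
    (p : ℕ → Space d → ℝ) (x : Space d) : ℝ :=
  (γ - 1) * (((γ - 1)⁻¹ + 1) * divg (fun y => p 0 y • u 1 y + p 1 y • u 0 y) x +
    ρ 0 x * inner ℝ (u 1 x) (gradient Φ x))

namespace IsPrepared

theorem fderiv_density_velocity (hw : IsPrepared D m Φ (K + 2) rho vel pres ρ u p) {x : Space d}
    (hx : x ∈ D) : fderiv ℝ (ρ 0) x (u 0 x) = 0 := by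
  have h := hw.div_momentum x hx
  rw [divg_smul ((hw.density.coeff 0 (by omega)).differentiableAt hw.isOpen hx)
    ((hw.velocity.coeff 0 (by omega)).differentiableAt hw.isOpen hx), hw.div_velocity x hx] at h
  simpa using h

/-- `∇p₀` is parallel to `∇Φ` by hydrostatic balance, and `u₀` is orthogonal to `∇Φ`. -/
theorem fderiv_pressure_velocity (hw : IsPrepared D m Φ (K + 2) rho vel pres ρ u p) {x : Space d}
    (hx : x ∈ D) : fderiv ℝ (p 0) x (u 0 x) = 0 := by
  rw [← inner_gradient, hw.gradient_zero x hx, inner_neg_left, real_inner_smul_left,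
    real_inner_comm, hw.orthogonal x hx]
  simp

theorem new_density (hw : IsPrepared D m Φ (K + 2) rho vel pres ρ u p) (dt : ℝ)
    {rho' : ℝ → Space d → ℝ}
    (hrho : ∀ᶠ M : ℝ in 𝓝[>] 0, ∀ x ∈ D,
      rho' M x = rho M x - dt * divg (fun y => rho M y • vel M y) x) :
    ∃ ρ', HasMachExpansion D (K + 2) rho' ρ' ∧ (∀ x ∈ D, ρ' 0 x = ρ 0 x) ∧
      (∀ x ∈ D, ρ' 1 x = ρ 1 x - dt * densityRate ρ u x) := by
  have hD := hw.isOpen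
  refine ⟨_, (hw.density.sub hD (((hw.density.smul hD hw.velocity).divg hD).const_smul hD dt)).congr
    hD ?_, fun x hx => ?_, fun x hx => ?_⟩
  · filter_upwards [hrho] with M hM x hx using (hM x hx).symm
  · simp only [Finset.HasAntidiagonal.antidiagonal_zero, Finset.sum_singleton]
    rw [hw.div_momentum x hx, smul_zero, sub_zero]
  · simp only [sum_antidiagonal_one]
    rfl

/-- The coefficients of `∇ψ + ρ ∇Φ` of order zero and one vanish by the two hydrostatic relations,
so the `M⁻²` term has an expansion, shorter by two orders; hence `K` in place of `K + 2`. -/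
theorem new_velocity (hw : IsPrepared D m Φ (K + 2) rho vel pres ρ u p) (dt : ℝ)
    {psi : ℝ → Space d → ℝ} {ψ : ℕ → Space d → ℝ} (hψ : HasMachExpansion D (K + 2) psi ψ)
    (hψ0 : ∀ x ∈ D, gradient (ψ 0) x = gradient (p 0) x)
    (hψ1 : ∀ x ∈ D, gradient (ψ 1) x = gradient (p 1) x)
    {X : Space d → Space d}
    (hX : ∀ x ∈ D, ρ 0 x • X x = gradient (ψ 2) x + ρ 2 x • gradient Φ x)
    {rho' : ℝ → Space d → ℝ} {ρ' : ℕ → Space d → ℝ} (hρ' : HasMachExpansion D (K + 2) rho' ρ')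
    (hρ'0 : ∀ x ∈ D, ρ' 0 x = ρ 0 x) {vel' : ℝ → Space d → Space d}
    (hvel : ∀ᶠ M : ℝ in 𝓝[>] 0, ∀ x ∈ D, vel' M x = (rho' M x)⁻¹ • (rho M x • vel M x
      - dt • (advect (vel M) (fun y => rho M y • vel M y) x
        + divg (vel M) x • (rho M x • vel M x) + (gradient (pres M) x - gradient (psi M) x))
      - dt • ((M ^ 2)⁻¹ • (gradient (psi M) x + rho M x • gradient Φ x)))) :
    ∃ u', HasMachExpansion D K vel' u' ∧
      ∀ x ∈ D, u' 0 x = u 0 x - dt • (advect (u 0) (u 0) x + X x) := by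
  have hD := hw.isOpen
  have hG := hw.potential.gradient hD
  have hY := (hψ.gradient hD).add hD (hw.density.smul_const hD hG)
  have hY2 := hY.unshift hD (m := 2) (fun k hk x hx => by
    obtain rfl | rfl : k = 0 ∨ k = 1 := by omega
    · rw [hψ0 x hx, hw.gradient_zero x hx, neg_add_cancel]
    · rw [hψ1 x hx, hw.gradient_one x hx, neg_add_cancel])
  have hm := hw.density.smul hD hw.velocity
  have hmom := (hm.sub hD ((((hw.velocity.advect hD hm).add hD
    ((hw.velocity.divg hD).smul hD hm)).add hD
    ((hw.pressure.gradient hD).sub hD (hψ.gradient hD))).const_smul hD dt)).truncate hD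
      (Nat.le_add_right K 2) |>.sub hD (hY2.const_smul hD dt)
  have hρK := hρ'.truncate hD (Nat.le_add_right K 2)
  have hle : ∀ x ∈ D, m ≤ ρ' 0 x := fun x hx => by
    rw [hρ'0 x hx]
    exact hw.le_density x hx
  have hpos := hρ'.eventually_lt hD hw.pos hle
  obtain ⟨u', hu'⟩ := hmom.exists_inv_smul hD hρK (half_pos hw.pos) hpos
    fun x hx => (half_le_self hw.pos.le).trans (hle x hx)
  refine ⟨u', hu'.congr hD ?_, fun x hx => ?_⟩
  · filter_upwards [hvel] with M hM x hx
    rw [hM x hx]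
  -- The leading velocity is identified by comparing `ρ' u'` with the momentum at order zero.
  have huniq := ((hρK.smul hD hu').congr hD (g := fun M x => _) (by
    filter_upwards [hpos] with M hM x hx
    exact smul_inv_smul₀ ((half_pos hw.pos).trans (hM x hx)).ne' _)).unique hD hmom
  have h0 := huniq 0 (Nat.zero_le K) x hx
  simp only [Finset.HasAntidiagonal.antidiagonal_zero, Finset.sum_singleton,
    zero_add] at h0
  have hρd := (hw.density.coeff 0 (by omega)).differentiableAt hD hx
  have hud := (hw.velocity.coeff 0 (by omega)).differentiableAt hD hx
  -- `u₀ · ∇ρ₀ = 0` follows from the two divergence constraints, so momentum transport reduces to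
  -- `ρ₀ u₀ · ∇u₀`.
  have hadv : fderiv ℝ (fun y => ρ 0 y • u 0 y) x (u 0 x) = ρ 0 x • advect (u 0) (u 0) x := by
    rw [fderiv_fun_smul hρd hud]
    simp [hw.fderiv_density_velocity hx, advect]
  rw [hadv, hw.div_velocity x hx, zero_smul, hψ0 x hx, sub_self, add_zero, add_zero, ← hX x hx,
    hρ'0 x hx] at h0
  have hne : ρ 0 x ≠ 0 := (hw.pos.trans_le (hw.le_density x hx)).ne'
  refine smul_right_injective _ hne ?_
  simp only
  rw [h0]
  module

/-- The kinetic energies carry a factor `M²`. They do not affect orders zero and one, and the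
velocity expansion to order `K` is enough for the pressure to order `K + 2`. -/
theorem new_pressure (hw : IsPrepared D m Φ (K + 2) rho vel pres ρ u p) (dt : ℝ) {γ : ℝ}
    (hγ : 1 < γ) {psi : ℝ → Space d → ℝ} {ψ : ℕ → Space d → ℝ}
    (hψ : HasMachExpansion D (K + 2) psi ψ) {κ : ℝ} (hψ0 : ∀ x ∈ D, ψ 0 x = p 0 x + κ)
    (hψ1 : ∀ x ∈ D, gradient (ψ 1) x = gradient (p 1) x)
    {rho' : ℝ → Space d → ℝ} {ρ' : ℕ → Space d → ℝ} (hρ' : HasMachExpansion D (K + 2) rho' ρ')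
    {vel' : ℝ → Space d → Space d} {u' : ℕ → Space d → Space d}
    (hu' : HasMachExpansion D K vel' u') {en en' pres' : ℝ → Space d → ℝ}
    (hen : ∀ᶠ M : ℝ in 𝓝[>] 0, ∀ x ∈ D, en M x =
      (γ - 1)⁻¹ * pres M x + 1 / 2 * M ^ 2 * rho M x * inner ℝ (vel M x) (vel M x))
    (hen' : ∀ᶠ M : ℝ in 𝓝[>] 0, ∀ x ∈ D, en' M x = en M x
      - dt * divg (fun y => (en M y + M ^ 2 * pres M y + (1 - M ^ 2) * psi M y) • vel M y) x
      - dt * (rho M x * inner ℝ (vel M x) (gradient Φ x)))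
    (hpres' : ∀ᶠ M : ℝ in 𝓝[>] 0, ∀ x ∈ D, pres' M x =
      (γ - 1) * (en' M x - 1 / 2 * M ^ 2 * rho' M x * inner ℝ (vel' M x) (vel' M x))) :
    ∃ p', HasMachExpansion D (K + 2) pres' p' ∧ (∀ x ∈ D, p' 0 x = p 0 x) ∧
      ∀ x ∈ D, p' 1 x = p 1 x - dt * (pressureRate γ Φ ρ u p x + κ * ((γ - 1) * divg (u 1) x)) := by
  have hD := hw.isOpen
  have hG := hw.potential.gradient hD
  have hγ0 : γ - 1 ≠ 0 := sub_ne_zero.2 hγ.ne'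
  obtain ⟨e, he, he01⟩ : ∃ e, HasMachExpansion D (K + 2) en e ∧
      ∀ k < 2, ∀ x, e k x = (γ - 1)⁻¹ * p k x := by
    refine ⟨_, ((hw.pressure.const_smul hD (γ - 1)⁻¹).add hD
      ((((hw.density.smul hD (hw.velocity.inner hD hw.velocity)).const_smul hD
        (1 / 2)).truncate hD (Nat.le_add_right K 2)).shift hD 2)).congr hD ?_, fun k hk x => ?_⟩
    · filter_upwards [hen] with M hM x hx
      rw [hM x hx]
      simp only [smul_eq_mul]
      ring
    · simp [hk]
  -- The enthalpy factor of the energy flux is `(E + ψ) + M² (p - ψ)`; the second part starts at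
  -- order two.
  obtain ⟨H, hH, hH01⟩ : ∃ H, HasMachExpansion D (K + 2)
      (fun M y => en M y + M ^ 2 * pres M y + (1 - M ^ 2) * psi M y) H ∧
      ∀ k < 2, ∀ x, H k x = (γ - 1)⁻¹ * p k x + ψ k x := by
    refine ⟨_, ((he.add hD hψ).add hD (((hw.pressure.sub hD hψ).truncate hD
      (Nat.le_add_right K 2)).shift hD 2)).congr hD ?_, fun k hk x => ?_⟩
    · refine Eventually.of_forall fun M x hx => ?_
      simp only [smul_eq_mul]
      ring
    · simp [hk, he01 k hk x]
  have hE := (he.sub hD (((hH.smul hD hw.velocity).divg hD).const_smul hD dt)).sub hD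
    (((hw.density.smul hD (hw.velocity.inner_const hD hG))).const_smul hD dt)
  have hkin := (((hρ'.truncate hD (Nat.le_add_right K 2)).smul hD
    (hu'.inner hD hu')).const_smul hD (1 / 2)).shift hD 2
  have hpc : ∀ k ≤ 2, SmoothBdd D (p k) := fun k hk => hw.pressure.coeff k (by omega)
  have huc : ∀ k ≤ 2, SmoothBdd D (u k) := fun k hk => hw.velocity.coeff k (by omega)
  refine ⟨_, ((hE.sub hD hkin).const_smul hD (γ - 1)).congr hD ?_, fun x hx => ?_, fun x hx => ?_⟩
  · filter_upwards [hen', hpres'] with M h1 h2 x hx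
    rw [h2 x hx, h1 x hx]
    simp only [smul_eq_mul]
    ring
  · have hp0 := (hpc 0 (by omega)).differentiableAt hD hx
    have hu0 := (huc 0 (by omega)).differentiableAt hD hx
    -- The zeroth order energy flux is divergence free: `u₀` is divergence free, `p₀` is constant
    -- along `u₀`, and so is the constant `κ`.
    have hdiv : divg (fun y => H 0 y • u 0 y) x = 0 := by
      rw [divg_congr_on hD (W := fun y => (((γ - 1)⁻¹ + 1) * p 0 y + κ) • u 0 y) (fun y hy => by
        simp only [hH01 0 (by omega), hψ0 y hy]
        congr 1
        ring) hx, divg_smul ((hp0.const_mul _).add_const κ) hu0, hw.div_velocity x hx,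
        fderiv_add_const, fderiv_const_mul hp0, smul_apply, hw.fderiv_pressure_velocity hx]
      simp
    simp only [Finset.HasAntidiagonal.antidiagonal_zero, Finset.sum_singleton, smul_eq_mul]
    rw [hdiv, hw.orthogonal x hx, he01 0 (by omega)]
    simp [hγ0]
  · have hp0 := (hpc 0 (by omega)).differentiableAt hD hx
    have hp1 := (hpc 1 (by omega)).differentiableAt hD hx
    have hu0 := (huc 0 (by omega)).differentiableAt hD hx
    have hu1 := (huc 1 (by omega)).differentiableAt hD hx
    have hψ1d := (hψ.coeff 1 (by omega)).differentiableAt hD hx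
    -- Since `∇·u₀ = 0`, `ψ₁` enters the divergence only through `u₀ · ∇ψ₁`, where it can be
    -- replaced by `p₁`. The rate thus depends on the implicit pressure through `κ` alone.
    have hfd : fderiv ℝ (ψ 1) x (u 0 x) = fderiv ℝ (p 1) x (u 0 x) := by
      rw [← inner_gradient, ← inner_gradient, hψ1 x hx]
    have ha : DifferentiableAt ℝ (fun y => ((γ - 1)⁻¹ + 1) * p 0 y + κ) x :=
      (hp0.const_mul _).add_const κ
    have hb : DifferentiableAt ℝ (fun y => (γ - 1)⁻¹ * p 1 y + ψ 1 y) x :=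
      (hp1.const_mul _).add hψ1d
    have hb' : fderiv ℝ (fun y => (γ - 1)⁻¹ * p 1 y + ψ 1 y) x =
        (γ - 1)⁻¹ • fderiv ℝ (p 1) x + fderiv ℝ (ψ 1) x := by
      rw [fderiv_fun_add (hp1.const_mul _) hψ1d, fderiv_const_mul hp1]
    have hdiv : divg (fun y => H 0 y • u 1 y + H 1 y • u 0 y) x =
        ((γ - 1)⁻¹ + 1) * divg (fun y => p 0 y • u 1 y + p 1 y • u 0 y) x + κ * divg (u 1) x := by
      rw [divg_congr_on hD (W := fun y => (((γ - 1)⁻¹ + 1) * p 0 y + κ) • u 1 y +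
          ((γ - 1)⁻¹ * p 1 y + ψ 1 y) • u 0 y) (fun y hy => by
        simp only [hH01 0 (by omega), hH01 1 (by omega), hψ0 y hy]
        congr 2
        ring) hx, divg_add (ha.fun_smul hu1) (hb.fun_smul hu0), divg_smul ha hu1, divg_smul hb hu0,
        divg_add (hp0.fun_smul hu1) (hp1.fun_smul hu0), divg_smul hp0 hu1, divg_smul hp1 hu0,
        hw.div_velocity x hx, fderiv_add_const, fderiv_const_mul hp0, hb']
      simp only [add_apply, smul_apply, smul_eq_mul, hfd]
      ring
    simp only [sum_antidiagonal_one, smul_eq_mul]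
    rw [hdiv, hw.orthogonal x hx, he01 1 (by omega), pressureRate, if_pos (by omega)]
    field_simp
    ring

end IsPrepared

end NewTime

/-! ### Uniform estimates for the step -/

section Estimates

variable {d : ℕ} {D : Set (Space d)} {m : ℝ} {Φ : Space d → ℝ} {K : ℕ}
    {rho : ℝ → Space d → ℝ} {vel : ℝ → Space d → Space d} {pres : ℝ → Space d → ℝ}
    {ρ : ℕ → Space d → ℝ} {u : ℕ → Space d → Space d} {p : ℕ → Space d → ℝ}

/-- The leading coefficients `ρ'`, `u'`, `p'` at the new time level, in terms of the data, of the
constant `κ = ψ₀ - p₀` and of the field `X = (∇ψ₂ + ρ₂ ∇Φ) / ρ₀`. -/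
structure IsStepExpansion (D : Set (Space d)) (γ a dt : ℝ) (Φ : Space d → ℝ)
    (ρ : ℕ → Space d → ℝ) (u : ℕ → Space d → Space d) (p : ℕ → Space d → ℝ) (ψ₂ : Space d → ℝ)
    (κ : ℝ) (X : Space d → Space d)
    (ρ' : ℕ → Space d → ℝ) (u' : ℕ → Space d → Space d) (p' : ℕ → Space d → ℝ) : Prop where
  smooth : SmoothBdd D X
  smul_eq : ∀ x ∈ D, ρ 0 x • X x = gradient ψ₂ x + ρ 2 x • gradient Φ x
  divg_eq : ∀ x ∈ D, divg X x = κ / (dt ^ 2 * a ^ 2) * ρ 0 x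
  density_zero : ∀ x ∈ D, ρ' 0 x = ρ 0 x
  density_one : ∀ x ∈ D, ρ' 1 x = ρ 1 x - dt * densityRate ρ u x
  velocity_zero : ∀ x ∈ D, u' 0 x = u 0 x - dt • (advect (u 0) (u 0) x + X x)
  pressure_zero : ∀ x ∈ D, p' 0 x = p 0 x
  pressure_one : ∀ x ∈ D,
    p' 1 x = p 1 x - dt * (pressureRate γ Φ ρ u p x + κ * ((γ - 1) * divg (u 1) x))

theorem IsPrepared.exists_step_expansion
    {γ a dt : ℝ} {α β : Space d → ℝ} {w : ℝ → State d} {W₁ W₂ Wnew : ℝ → RelaxState d}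
    (hw : IsPrepared D m Φ (K + 2) (fun M => (w M).rho) (fun M => (w M).velocity)
      (fun M => (w M).pressure γ M) ρ u p)
    (hc : IsConnected D) (hb : Bornology.IsBounded D) (hγ : 1 < γ) (ha : 0 < a) (hdt : 0 < dt)
    (hαne : ∀ x ∈ D, α x ≠ 0) (hβ : ∀ x ∈ D, gradient β x = -(α x • gradient Φ x))
    (hstep : ∀ᶠ M in 𝓝[>] (0 : ℝ), IsIMEXStep D γ a M dt α β (w M) (W₁ M) (W₂ M) (Wnew M))
    {ψ : ℕ → Space d → ℝ} (hψ : HasMachExpansion D (K + 2) (fun M => (W₁ M).psi) ψ)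
    (hbc : ∀ k ≤ 1, ∀ y ∈ frontier D,
      Tendsto (fun x => gradient (ψ k) x - gradient (p k) x) (𝓝[D] y) (𝓝 0)) :
    ∃ κ X ρ' u' p', IsStepExpansion D γ a dt Φ ρ u p (ψ 2) κ X ρ' u' p' ∧
      HasMachExpansion D (K + 2) (fun M => (Wnew M).phys.rho) ρ' ∧
      HasMachExpansion D K (fun M => (Wnew M).phys.velocity) u' ∧
      HasMachExpansion D (K + 2) (fun M => (Wnew M).phys.pressure γ M) p' := by
  have hD := hw.isOpen
  -- The expansions supply smoothness and a positive density for all small `M`, so the pointwise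
  -- formulas for the step become available eventually.
  have hreg : ∀ᶠ M in 𝓝[>] (0 : ℝ),
      IsRegularStep D γ a M dt α β Φ (w M) (W₁ M) (W₂ M) (Wnew M) := by
    filter_upwards [hstep, eventually_pos_lt_one, hw.density.smooth, hw.velocity.smooth,
      hw.pressure.smooth, hψ.smooth, hw.density.eventually_lt hD hw.pos hw.le_density]
      with M h1 h2 h3 h4 h5 h6 h7
    exact ⟨hD, hγ, h2.1, h1, fun x hx => (half_pos hw.pos).trans (h7 x hx), hαne, hβ, h3, h4, h5,
      h6, hw.potential.smooth⟩
  obtain ⟨κ, X, hX, hψ0, hg0, hg1, hρX, hdivX⟩ := hw.implicit_pressure hc hb ha hdt hψ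
    (by filter_upwards [hreg] with M h x hx using h.elliptic hx) hbc
  obtain ⟨ρ', hρ', hρ'0, hρ'1⟩ := hw.new_density dt (rho' := fun M => (Wnew M).phys.rho)
    (by filter_upwards [hreg] with M h x hx using h.new_rho hx)
  obtain ⟨u', hu', hu'0⟩ := hw.new_velocity dt hψ hg0 hg1 hρX hρ' hρ'0
    (vel' := fun M => (Wnew M).phys.velocity) (by
      filter_upwards [hreg] with M h x hx
      rw [State.velocity]
      exact congrArg _ (h.new_mom hx))
  have hpos' := hρ'.eventually_lt hD hw.pos fun x hx => by
    rw [hρ'0 x hx]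
    exact hw.le_density x hx
  obtain ⟨p', hp', hp'0, hp'1⟩ := hw.new_pressure dt hγ hψ hψ0 hg1 hρ' hu'
    (en := fun M => (w M).energy) (en' := fun M => (Wnew M).phys.energy)
    (pres' := fun M => (Wnew M).phys.pressure γ M)
    (by filter_upwards [hreg] with M h x hx using h.energy_eq hx)
    (by filter_upwards [hreg] with M h x hx using h.new_energy hx)
    (by
      filter_upwards [hpos'] with M h x hx
      have := ((half_pos hw.pos).trans (h x hx)).ne'
      rw [State.pressure, State.internalEnergy, real_inner_self_eq_norm_sq, mul_assoc,
        mul_div_cancel₀ _ this])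
  exact ⟨κ, X, ρ', u', p', ⟨hX, hρX, hdivX, hρ'0, hρ'1, hu'0, hp'0, hp'1⟩, hρ', hu', hp'⟩

/-- The increments are `dt` times quantities built from the data, `X`, `∇·X` and `κ`. The bound on
`∇ψ₂` controls `X`, and the bump function estimate then controls `∇·X` and `κ`. No derivative of `X`
other than its divergence is needed. -/
theorem IsPrepared.exists_uniform_bound
    (hw : IsPrepared D m Φ (K + 2) rho vel pres ρ u p) (hc : IsConnected D) {a : ℝ} (ha : 0 < a)
    (γ : ℝ) {T : ℝ} (C₂ : ℝ) :
    ∃ C, ∀ (dt : ℝ) (ψ₂ : Space d → ℝ) (κ : ℝ) (X : Space d → Space d) (ρ' : ℕ → Space d → ℝ)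
      (u' : ℕ → Space d → Space d) (p' : ℕ → Space d → ℝ), dt ∈ Set.Ioc 0 T →
      (∀ x ∈ D, ‖gradient ψ₂ x‖ ≤ C₂) →
      IsStepExpansion D γ a dt Φ ρ u p ψ₂ κ X ρ' u' p' →
      ∀ x ∈ D, |ρ' 1 x - ρ 1 x| ≤ C * dt ∧ |p' 1 x - p 1 x| ≤ C * dt ∧
        ‖gradient (p' 0) x + ρ' 0 x • gradient Φ x‖ ≤ C * dt ∧
        ‖gradient (p' 1) x + ρ' 1 x • gradient Φ x‖ ≤ C * dt ∧
        |divg (fun y => ρ' 0 y • u' 0 y) x| ≤ C * dt ∧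
        |divg (u' 0) x| ≤ C * dt ∧ |inner ℝ (u' 0 x) (gradient Φ x)| ≤ C * dt := by
  have hD := hw.isOpen
  have hG := hw.potential.gradient hD
  have hρc : ∀ k ≤ 2, SmoothBdd D (ρ k) := fun k hk => hw.density.coeff k (by omega)
  have huc : ∀ k ≤ 2, SmoothBdd D (u k) := fun k hk => hw.velocity.coeff k (by omega)
  have hpc : ∀ k ≤ 2, SmoothBdd D (p k) := fun k hk => hw.pressure.coeff k (by omega)
  have h0 : (0 : ℕ) ≤ 2 := by omega
  have h1 : (1 : ℕ) ≤ 2 := by omega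
  have hr : SmoothBdd D (densityRate ρ u) :=
    (((hρc 0 h0).smul hD (huc 1 h1)).add hD ((hρc 1 h1).smul hD (huc 0 h0))).divg hD
  have hR : SmoothBdd D (pressureRate γ Φ ρ u p) :=
    (((((hpc 0 h0).smul hD (huc 1 h1)).add hD ((hpc 1 h1).smul hD (huc 0 h0))).divg hD
      |>.const_smul hD ((γ - 1)⁻¹ + 1)).add hD
      ((hρc 0 h0).mul hD ((huc 1 h1).inner hD hG))).const_smul hD (γ - 1)
  have hS : SmoothBdd D (fun x => (γ - 1) * divg (u 1) x) :=
    ((huc 1 h1).divg hD).const_smul hD (γ - 1)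
  have hA : SmoothBdd D (advect (u 0) (u 0)) := (huc 0 h0).advect hD (huc 0 h0)
  have hρA : SmoothBdd D (fun y => ρ 0 y • advect (u 0) (u 0) y) := (hρc 0 h0).smul hD hA
  obtain ⟨cG, cG0, hcG⟩ := hG.norm_le
  obtain ⟨cρ, cρ0, hcρ⟩ := (hρc 0 h0).norm_le
  obtain ⟨cρ', cρ'0, hcρ'⟩ := ((hρc 0 h0).fderiv hD).norm_le
  obtain ⟨c2, c20, hc2⟩ := (hρc 2 le_rfl).norm_le
  obtain ⟨cr, cr0, hcr⟩ := hr.norm_le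
  obtain ⟨cR, cR0, hcR⟩ := hR.norm_le
  obtain ⟨cR', cR'0, hcR'⟩ := (hR.gradient hD).norm_le
  obtain ⟨cS, cS0, hcS⟩ := hS.norm_le
  obtain ⟨cS', cS'0, hcS'⟩ := (hS.gradient hD).norm_le
  obtain ⟨cA, cA0, hcA⟩ := hA.norm_le
  obtain ⟨cA', cA'0, hcA'⟩ := (hA.divg hD).norm_le
  obtain ⟨cB, cB0, hcB⟩ := (hρA.divg hD).norm_le
  obtain ⟨Q, hQ0, hQ⟩ := exists_bound_of_divg_eq hD hc.nonempty hw.pos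
  -- `b` bounds `‖X‖`, then `q` bounds `|κ| / (dt² a²)`, and `k` bounds `|κ|` because `dt ≤ T`. The
  -- maximum with `0` makes `b` nonnegative whatever the sign of `C₂`.
  set b : ℝ := m⁻¹ * (max C₂ 0 + c2 * cG) with hb
  have hm := hw.pos
  have hb0 : 0 ≤ b := by positivity
  set q : ℝ := Q * b with hq
  have hq0 : 0 ≤ q := by positivity
  set k : ℝ := q * (T ^ 2 * a ^ 2) with hk
  have hk0 : 0 ≤ k := by positivity
  -- One summand for each estimate: first order density, first order pressure, first order
  -- hydrostatic balance, divergence of the momentum, divergence of the velocity, orthogonality. The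
  -- zeroth order hydrostatic residual is exactly zero.
  set C : ℝ := cr + (cR + k * cS) + (cR' + k * cS' + cr * cG) + (cB + cρ * (q * cρ) + cρ' * b)
    + (cA' + q * cρ) + (cA + b) * cG with hC
  refine ⟨C, fun dt ψ₂ κ X ρ' u' p' hdt hψ₂ h x hx => ?_⟩
  have hdt0 : 0 < dt := hdt.1
  have hXb : ∀ x ∈ D, ‖X x‖ ≤ b := fun x hx => by
    have hpos := hm.trans_le (hw.le_density x hx)
    have e1 : X x = (ρ 0 x)⁻¹ • (gradient ψ₂ x + ρ 2 x • gradient Φ x) := by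
      rw [← h.smul_eq x hx, inv_smul_smul₀ hpos.ne']
    rw [e1, norm_smul, norm_inv, Real.norm_of_nonneg hpos.le]
    refine mul_le_mul (inv_anti₀ hm (hw.le_density x hx)) ?_ (norm_nonneg _) (by positivity)
    refine (norm_add_le _ _).trans (add_le_add (le_max_of_le_left (hψ₂ x hx)) ?_)
    rw [norm_smul]
    exact mul_le_mul (hc2 x hx) (hcG x hx) (norm_nonneg _) c20
  have hκq : |κ / (dt ^ 2 * a ^ 2)| ≤ q := hQ X (ρ 0) _ b h.smooth hXb hw.le_density h.divg_eq
  have hκ : |κ| ≤ k := by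
    have e1 : |κ| = |κ / (dt ^ 2 * a ^ 2)| * (dt ^ 2 * a ^ 2) := by
      rw [abs_div, abs_of_pos (show 0 < dt ^ 2 * a ^ 2 by positivity),
        div_mul_cancel₀ _ (by positivity)]
    rw [e1, hk]
    have := hdt.2
    gcongr
  have hdX : |divg X x| ≤ q * cρ := by
    rw [h.divg_eq x hx, abs_mul]
    exact mul_le_mul hκq (hcρ x hx) (abs_nonneg _) hq0
  have hle : ∀ c, c ≤ C → c * dt ≤ C * dt := fun c hc => mul_le_mul_of_nonneg_right hc hdt0.le
  have hXd := h.smooth.differentiableAt hD hx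
  have hAd := hA.differentiableAt hD hx
  have hu0d := (huc 0 h0).differentiableAt hD hx
  have hρ0d := (hρc 0 h0).differentiableAt hD hx
  have t1 : 0 ≤ cR + k * cS := by positivity
  have t2 : 0 ≤ cR' + k * cS' + cr * cG := by positivity
  have t3 : 0 ≤ cB + cρ * (q * cρ) + cρ' * b := by positivity
  have t4 : 0 ≤ cA' + q * cρ := by positivity
  have t5 : 0 ≤ (cA + b) * cG := by positivity
  refine ⟨?_, ?_, ?_, ?_, ?_, ?_, ?_⟩
  · refine le_trans ?_ (hle cr (by linarith))
    rw [h.density_one x hx, sub_sub_cancel_left, abs_neg, abs_mul, abs_of_pos hdt0, mul_comm]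
    exact mul_le_mul_of_nonneg_right (hcr x hx) hdt0.le
  · refine le_trans ?_ (hle (cR + k * cS) (by linarith))
    rw [h.pressure_one x hx, sub_sub_cancel_left, abs_neg, abs_mul, abs_of_pos hdt0, mul_comm]
    refine mul_le_mul_of_nonneg_right ((abs_add_le _ _).trans (add_le_add (hcR x hx) ?_)) hdt0.le
    rw [abs_mul]
    exact mul_le_mul hκ (hcS x hx) (abs_nonneg _) hk0
  · rw [gradient_congr_on hD h.pressure_zero hx, h.density_zero x hx, hw.gradient_zero x hx,
      neg_add_cancel, norm_zero]
    exact mul_nonneg (by linarith) hdt0.le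
  · refine le_trans ?_ (hle (cR' + k * cS' + cr * cG) (by linarith))
    have hRd := hR.differentiableAt hD hx
    have hSd := hS.differentiableAt hD hx
    have hRS : DifferentiableAt ℝ
        (fun y => pressureRate γ Φ ρ u p y + κ * ((γ - 1) * divg (u 1) y)) x :=
      hRd.add (hSd.const_mul κ)
    -- The hydrostatic relation for the old `p 1`, `ρ 1` cancels, and only the rates of change
    -- remain. `κ` is a constant, so no gradient of it appears.
    have e1 : gradient (p' 1) x + ρ' 1 x • gradient Φ x = -(dt • (gradient (pressureRate γ Φ ρ u p) x
        + κ • gradient (fun y => (γ - 1) * divg (u 1) y) x + densityRate ρ u x • gradient Φ x)) := by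
      rw [gradient_congr_on hD h.pressure_one hx,
        gradient_sub ((hpc 1 h1).differentiableAt hD hx) (hRS.const_mul dt),
        gradient_const_mul hRS, gradient_add hRd (hSd.const_mul κ), gradient_const_mul hSd,
        h.density_one x hx, hw.gradient_one x hx]
      module
    rw [e1, norm_neg, norm_smul, Real.norm_of_nonneg hdt0.le, mul_comm]
    refine mul_le_mul_of_nonneg_right ?_ hdt0.le
    refine (norm_add_le _ _).trans (add_le_add ((norm_add_le _ _).trans
      (add_le_add (hcR' x hx) ?_)) ?_)
    · rw [norm_smul]
      exact mul_le_mul hκ (hcS' x hx) (norm_nonneg _) hk0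
    · rw [norm_smul]
      exact mul_le_mul (hcr x hx) (hcG x hx) (norm_nonneg _) cr0
  · refine le_trans ?_ (hle (cB + cρ * (q * cρ) + cρ' * b) (by linarith))
    have hρAd := hρA.differentiableAt hD hx
    have hρXd : DifferentiableAt ℝ (fun y => ρ 0 y • X y) x := hρ0d.fun_smul hXd
    -- `∇·(ρ₀ X)` is expanded by the product rule, which brings in only `∇·X` and the size of `X`.
    have e1 : divg (fun y => ρ' 0 y • u' 0 y) x =
        -(dt * (divg (fun y => ρ 0 y • advect (u 0) (u 0) y) x +
          ρ 0 x * divg X x + fderiv ℝ (ρ 0) x (X x))) := by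
      rw [divg_congr_on hD (W := fun y => ρ 0 y • u 0 y -
          dt • (ρ 0 y • advect (u 0) (u 0) y + ρ 0 y • X y)) (fun y hy => by
          simp only [h.density_zero y hy, h.velocity_zero y hy]
          module) hx,
        divg_sub (hρ0d.fun_smul hu0d) ((hρAd.fun_add hρXd).fun_const_smul dt),
        divg_const_smul (hρAd.fun_add hρXd), divg_add hρAd hρXd, divg_smul hρ0d hXd,
        hw.div_momentum x hx]
      ring
    rw [e1, abs_neg, abs_mul, abs_of_pos hdt0, mul_comm]
    refine mul_le_mul_of_nonneg_right ?_ hdt0.le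
    refine (abs_add_le _ _).trans (add_le_add ((abs_add_le _ _).trans
      (add_le_add (hcB x hx) ?_)) ?_)
    · rw [abs_mul]
      exact mul_le_mul (hcρ x hx) hdX (abs_nonneg _) cρ0
    · exact ((fderiv ℝ (ρ 0) x).le_opNorm (X x)).trans
        (mul_le_mul (hcρ' x hx) (hXb x hx) (norm_nonneg _) cρ'0)
  · refine le_trans ?_ (hle (cA' + q * cρ) (by linarith))
    rw [divg_congr_on hD h.velocity_zero hx,
      divg_sub hu0d ((hAd.fun_add hXd).fun_const_smul dt), divg_const_smul (hAd.fun_add hXd),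
      divg_add hAd hXd, hw.div_velocity x hx, zero_sub, abs_neg, abs_mul, abs_of_pos hdt0, mul_comm]
    exact mul_le_mul_of_nonneg_right ((abs_add_le _ _).trans (add_le_add (hcA' x hx) hdX)) hdt0.le
  · refine le_trans ?_ (hle ((cA + b) * cG) (by linarith))
    rw [h.velocity_zero x hx, inner_sub_left, hw.orthogonal x hx, zero_sub, abs_neg,
      real_inner_smul_left, abs_mul, abs_of_pos hdt0, mul_comm]
    refine mul_le_mul_of_nonneg_right ((abs_real_inner_le_norm _ _).trans ?_) hdt0.le
    exact mul_le_mul ((norm_add_le _ _).trans (add_le_add (hcA x hx) (hXb x hx))) (hcG x hx)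
      (norm_nonneg _) (by positivity)

end Estimates

end LowMach

end

/-! ### The asymptotic-preserving property -/

theorem mainTheorem1 {d : ℕ} (D : Set (LowMach.Space d))
    (hDo : IsOpen D) (hDc : IsConnected D) (hDb : Bornology.IsBounded D)
    (γ a : ℝ) (hγ : 1 < γ) (ha : 0 < a)
    -- the potential and the reference equilibrium, `∇β = - α ∇Φ`
    (Φ α β : LowMach.Space d → ℝ)
    (hΦ : LowMach.SmoothBdd D Φ) (hα : LowMach.SmoothBdd D α) (hβ : LowMach.SmoothBdd D β)
    (hαpos : ∃ m > 0, ∀ x ∈ D, m ≤ α x)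
    (hβΦ : ∀ x ∈ D, gradient β x = -(α x • gradient Φ x))
    -- well-prepared data at time level `n`
    (K : ℕ) (w : ℝ → LowMach.State d)
    (ρ : ℕ → LowMach.Space d → ℝ) (u : ℕ → LowMach.Space d → LowMach.Space d)
    (p : ℕ → LowMach.Space d → ℝ)
    (hρ : LowMach.HasMachExpansion D (K + 2) (fun M => (w M).rho) ρ)
    (hu : LowMach.HasMachExpansion D (K + 2) (fun M => (w M).velocity) u)
    (hp : LowMach.HasMachExpansion D (K + 2) (fun M => (w M).pressure γ M) p)
    (hρpos : ∃ m > 0, ∀ x ∈ D, m ≤ ρ 0 x)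
    (hwp : LowMach.IsWellPrepared D α β ρ u p)
    -- one step of the scheme, for every `dt ∈ (0, T]` and all small `M`
    (T : ℝ) (hT : 0 < T) (W₁ W₂ Wnew : ℝ → ℝ → LowMach.RelaxState d)
    (hstep : ∀ dt ∈ Set.Ioc 0 T, ∀ᶠ M in 𝓝[>] (0 : ℝ),
      LowMach.IsIMEXStep D γ a M dt α β (w M) (W₁ dt M) (W₂ dt M) (Wnew dt M))
    -- the expansion of the implicit pressure
    (ψ : ℝ → ℕ → LowMach.Space d → ℝ)
    (hψ : ∀ dt ∈ Set.Ioc 0 T,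
      LowMach.HasMachExpansion D (K + 2) (fun M => (W₁ dt M).psi) (ψ dt))
    (hψ₂ : ∃ C : ℝ, ∀ dt ∈ Set.Ioc 0 T, ∀ x ∈ D, ‖gradient (ψ dt 2) x‖ ≤ C)
    -- the boundary conditions `∇ψ₀ = ∇p₀`, `∇ψ₁ = ∇p₁`
    (hbc : ∀ dt ∈ Set.Ioc 0 T, ∀ k ≤ 1, ∀ y ∈ frontier D,
      Tendsto (fun x => gradient (ψ dt k) x - gradient (p k) x) (𝓝[D] y) (𝓝 0)) :
    ∃ (ρ' : ℝ → ℕ → LowMach.Space d → ℝ) (u' : ℝ → ℕ → LowMach.Space d → LowMach.Space d)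
      (p' : ℝ → ℕ → LowMach.Space d → ℝ),
      (∀ dt ∈ Set.Ioc 0 T,
        LowMach.HasMachExpansion D (K + 2) (fun M => (Wnew dt M).phys.rho) (ρ' dt) ∧
        LowMach.HasMachExpansion D K (fun M => (Wnew dt M).phys.velocity) (u' dt) ∧
        LowMach.HasMachExpansion D (K + 2) (fun M => (Wnew dt M).phys.pressure γ M) (p' dt)) ∧
      (∀ dt ∈ Set.Ioc 0 T, ∀ x ∈ D, ρ' dt 0 x = ρ 0 x ∧ p' dt 0 x = p 0 x) ∧
      ∃ C : ℝ, ∀ dt ∈ Set.Ioc 0 T,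
        (∀ x ∈ D, |ρ' dt 1 x - ρ 1 x| ≤ C * dt ∧ |p' dt 1 x - p 1 x| ≤ C * dt) ∧
        LowMach.IsWellPreparedUpTo (C * dt) D α β (ρ' dt) (u' dt) (p' dt) ∧
        LowMach.IsLimitStepUpTo (C * dt) D dt Φ (ρ 0) (ρ 2) (ψ dt 2) (u 0)
          (ρ' dt 0) (u' dt 0) := by
  obtain ⟨m, hm, hmρ⟩ := hρpos
  obtain ⟨mα, hmα, hαm⟩ := hαpos
  obtain ⟨C₂, hC₂⟩ := hψ₂
  have hαne : ∀ x ∈ D, α x ≠ 0 := fun x hx => (hmα.trans_le (hαm x hx)).ne'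
  have hg : ∀ x ∈ D, (α x)⁻¹ • gradient β x = -gradient Φ x := fun x hx => by
    rw [hβΦ x hx, smul_neg, inv_smul_smul₀ (hαne x hx)]
  have hw : LowMach.IsPrepared D m Φ (K + 2) (fun M => (w M).rho) (fun M => (w M).velocity)
      (fun M => (w M).pressure γ M) ρ u p :=
    { isOpen := hDo
      pos := hm
      potential := hΦ
      density := hρ
      velocity := hu
      pressure := hp
      le_density := hmρ
      gradient_zero := fun x hx => by rw [hwp.hydrostatic_zero x hx, hg x hx, smul_neg]
      gradient_one := fun x hx => by rw [hwp.hydrostatic_one x hx, hg x hx, smul_neg]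
      div_momentum := hwp.div_momentum
      div_velocity := hwp.div_velocity
      orthogonal := fun x hx => by
        have := hwp.orthogonal x hx
        rwa [hg x hx, inner_neg_right, neg_eq_zero] at this }
  -- Stated for every real `dt`, with zero as a dummy value outside `(0, T]`, so that choice yields
  -- coefficients as functions of `dt`.
  have hex : ∀ dt, ∃ κ X ρ' u' p', dt ∈ Set.Ioc 0 T →
      LowMach.IsStepExpansion D γ a dt Φ ρ u p (ψ dt 2) κ X ρ' u' p' ∧
      LowMach.HasMachExpansion D (K + 2) (fun M => (Wnew dt M).phys.rho) ρ' ∧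
      LowMach.HasMachExpansion D K (fun M => (Wnew dt M).phys.velocity) u' ∧
      LowMach.HasMachExpansion D (K + 2) (fun M => (Wnew dt M).phys.pressure γ M) p' := fun dt => by
    by_cases hdt : dt ∈ Set.Ioc 0 T
    · obtain ⟨κ, X, ρ', u', p', h⟩ := hw.exists_step_expansion hDc hDb hγ ha hdt.1 hαne hβΦ
        (hstep dt hdt) (hψ dt hdt) (hbc dt hdt)
      exact ⟨κ, X, ρ', u', p', fun _ => h⟩
    · exact ⟨0, 0, 0, 0, 0, fun h => absurd h hdt⟩
  choose κ X ρ' u' p' h using hex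
  obtain ⟨C, hC⟩ := hw.exists_uniform_bound hDc ha γ (T := T) C₂
  refine ⟨ρ', u', p', fun dt hdt => (h dt hdt).2, fun dt hdt x hx =>
    ⟨(h dt hdt).1.density_zero x hx, (h dt hdt).1.pressure_zero x hx⟩, C, fun dt hdt => ?_⟩
  have hs := (h dt hdt).1
  have hB := hC dt (ψ dt 2) (κ dt) (X dt) (ρ' dt) (u' dt) (p' dt) hdt (hC₂ dt hdt) hs
  refine ⟨fun x hx => ⟨(hB x hx).1, (hB x hx).2.1⟩,
    ⟨fun x hx => ?_, fun x hx => ?_, fun x hx => (hB x hx).2.2.2.2.1,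
      fun x hx => (hB x hx).2.2.2.2.2.1, fun x hx => ?_⟩,
    ⟨hs.density_zero, fun x hx => ?_, fun x hx => (hB x hx).2.2.2.2.1,
      fun x hx => (hB x hx).2.2.2.2.2.1, fun x hx => (hB x hx).2.2.2.2.2.2⟩⟩
  · rw [hg x hx, smul_neg, sub_neg_eq_add]
    exact (hB x hx).2.2.1
  · rw [hg x hx, smul_neg, sub_neg_eq_add]
    exact (hB x hx).2.2.2.1
  · rw [hg x hx, inner_neg_right, abs_neg]
    exact (hB x hx).2.2.2.2.2.2
  · have hne : ρ 0 x ≠ 0 := (hm.trans_le (hmρ x hx)).ne'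
    -- The velocity update is `(u₀' - u₀) / dt + u₀ · ∇u₀ = -X`, and dividing this relation by `ρ₀`
    -- gives `∇ψ₂ / ρ₀ = X - (ρ₂ / ρ₀) ∇Φ`; their sum is the discrete momentum equation.
    have e1 : gradient (ψ dt 2) x = ρ 0 x • X dt x - ρ 2 x • gradient Φ x :=
      eq_sub_of_add_eq (hs.smul_eq x hx).symm
    rw [hs.velocity_zero x hx, e1, sub_sub_cancel_left, smul_neg, inv_smul_smul₀ hdt.1.ne',
      smul_sub, inv_smul_smul₀ hne, smul_smul, div_eq_inv_mul]
    abel
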